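/- Let $N\ge 2$ and $\beta<1$. For a bounded domain $\Omega\subset\mathbb R^N$ with $\partial\Omega\in C^2$ put $d(x)=\operatorname{dist}(x,\partial\Omega)$, and consider the problem $$-\operatorname{div}(d^\beta\nabla u)=f\ \text{ in }\Omega,\qquad u=0\ \text{ on }\partial\Omega. \tag{P}$$ For $u\in C^2(\Omega)\cap C(\overline\Omega)$ and $f\in C(\overline\Omega)$, the equation means that $\int_\Omega d^\beta\,\nabla u\cdot\nabla\varphi\,dx=\int_\Omega f\varphi\,dx$ for all $\varphi\in C_c^\infty(\Omega)$ (the function $d$ need not be differentiable in all of $\Omega$). For $\alpha>0$ we write $u\in C^{0,\alpha}(\overline\Omega)$ if there is a constant $C$ with $|u(x)-u(y)|\le C|x-y|^\alpha$ for all $x,y\in\overline\Omega$. **(Upper bound.)** Suppose that $f\in C(\overline\Omega)$, $f\ge 0$ and $f\not\equiv 0$ in $\Omega$, and that $u\in C^2(\Omega)\cap C(\overline\Omega)$ solves (P). If $u\in C^{0,\alpha}(\overline\Omega)$ for some $\alpha>0$, then $\alpha\le\min\{1,1-\beta\}$. **(Sharpness.)** Let $\Omega=B_1$ be the open unit ball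 of $\mathbb R^N$ centred at the origin, which is a bounded domain with $C^2$ boundary. (i) If $0\le\beta<1$, the function $$u_1(x)=\int_{|x|}^1 s^{1-N}(1-s)^{-\beta}\Big(\int_0^s t^{N-1}(1-t)^\beta\,dt\Big)ds$$ is in $C^2(B_1)\cap C(\overline{B_1})$, is positive in $B_1$ and solves (P) with $f=d^\beta$, which satisfies the hypotheses on $f$ above; $u_1(x)/(1-|x|)^{1-\beta}$ tends to a positive constant as $|x|\to1^-$; and, for $\alpha>0$, $u_1\in C^{0,\alpha}(\overline{B_1})$ if and only if $\alpha\le 1-\beta$. (ii) For every $\beta<1$, the function $$u_2(x)=\frac{1+(1-\beta)|x|}{N(1-\beta)(2-\beta)}\,(1-|x|)^{1-\beta}$$ is in $C^2(B_1)\cap C(\overline{B_1})$, is positive in $B_1$ and solves (P) with $f=1$; and, for $\alpha>0$, $u_2\in C^{0,\alpha}(\overline{B_1})$ if and only if $\alpha\le\min\{1,1-\beta\}$. -/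

import Mathlib

open Set Filter Topology MeasureTheory
open scoped NNReal ContDiff

noncomputable section

namespace DegeneratePoisson

variable {N : ℕ}

/-- A bounded domain of `ℝ^N` (nonempty, open, connected, bounded) with boundary of class `C²`:
near each boundary point, `Ω` is the positivity set of a `C²` function without critical points,
so that `Ω` lies locally on one side of the `C²` hypersurface `∂Ω`. -/
structure IsBoundedC2Domain (Ω : Set (EuclideanSpace ℝ (Fin N))) : Prop where
  isOpen : IsOpen Ω
  isConnected : IsConnected Ω
  isBounded : Bornology.IsBounded Ω
  boundary : ∀ x₀ ∈ frontier Ω, ∃ (U : Set (EuclideanSpace ℝ (Fin N)))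
    (ρ : EuclideanSpace ℝ (Fin N) → ℝ), IsOpen U ∧ x₀ ∈ U ∧ ContDiffOn ℝ 2 ρ U ∧
      (∀ x ∈ U, fderiv ℝ ρ x ≠ 0) ∧ Ω ∩ U = {x ∈ U | 0 < ρ x}

/-- The distance to the boundary, `d(x) = dist(x, ∂Ω)`. -/
def bdryDist (Ω : Set (EuclideanSpace ℝ (Fin N))) (x : EuclideanSpace ℝ (Fin N)) : ℝ :=
  Metric.infDist x (frontier Ω)

/-- The equation `-div(d^β ∇u) = f` in `Ω`, tested against `φ ∈ C_c^∞(Ω)`. Since `d` is only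
Lipschitz continuous in `Ω`, the divergence cannot be taken pointwise in general, even if `u` is
of class `C²`. -/
def SolvesEquation (Ω : Set (EuclideanSpace ℝ (Fin N))) (β : ℝ)
    (f u : EuclideanSpace ℝ (Fin N) → ℝ) : Prop :=
  ∀ φ : EuclideanSpace ℝ (Fin N) → ℝ, ContDiff ℝ ∞ φ → HasCompactSupport φ → tsupport φ ⊆ Ω →
    ∫ x in Ω, bdryDist Ω x ^ β * inner ℝ (gradient u x) (gradient φ x) = ∫ x in Ω, f x * φ x

/-- `u ∈ C²(Ω) ∩ C(Ω̄)` solves `-div(d^β ∇u) = f` in `Ω`, `u = 0` on `∂Ω`. -/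
structure IsSolution (Ω : Set (EuclideanSpace ℝ (Fin N))) (β : ℝ)
    (f u : EuclideanSpace ℝ (Fin N) → ℝ) : Prop where
  contDiffOn : ContDiffOn ℝ 2 u Ω
  continuousOn : ContinuousOn u (closure Ω)
  equation : SolvesEquation Ω β f u
  boundary : ∀ x ∈ frontier Ω, u x = 0

/-- `f ∈ C(Ω̄)`, `f ≥ 0` and `f ≢ 0` in `Ω`. -/
structure IsSource (Ω : Set (EuclideanSpace ℝ (Fin N)))
    (f : EuclideanSpace ℝ (Fin N) → ℝ) : Prop where
  continuousOn : ContinuousOn f (closure Ω)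
  nonneg : ∀ x ∈ Ω, 0 ≤ f x
  ne_zero : ∃ x ∈ Ω, f x ≠ 0

/-- `u ∈ C^{0,α}(Ω̄)`, for `α > 0` (exponents `α > 1` are not excluded). -/
def IsHolderUpToBoundary (Ω : Set (EuclideanSpace ℝ (Fin N))) (α : ℝ≥0)
    (u : EuclideanSpace ℝ (Fin N) → ℝ) : Prop :=
  ∃ C : ℝ≥0, HolderOnWith C α u (closure Ω)

/-- The open unit ball of `ℝ^N`. -/
def unitBall (N : ℕ) : Set (EuclideanSpace ℝ (Fin N)) := Metric.ball 0 1

/-- `∫_{|x|}^1 s^{1-N} (1-s)^{-β} (∫_0^s t^{N-1} (1-t)^β dt) ds`. -/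
def radialSolution₁ (N : ℕ) (β : ℝ) (x : EuclideanSpace ℝ (Fin N)) : ℝ :=
  ∫ s in ‖x‖..1, s ^ (1 - (N : ℝ)) * (1 - s) ^ (-β) *
    ∫ t in (0 : ℝ)..s, t ^ ((N : ℝ) - 1) * (1 - t) ^ β

/-- `(1 + (1-β)|x|) (1-|x|)^{1-β} / (N (1-β) (2-β))`. -/
def radialSolution₂ (N : ℕ) (β : ℝ) (x : EuclideanSpace ℝ (Fin N)) : ℝ :=
  (1 + (1 - β) * ‖x‖) / (N * (1 - β) * (2 - β)) * (1 - ‖x‖) ^ (1 - β)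

end DegeneratePoisson

end

open DegeneratePoisson

/-! ### Integration by parts against compactly supported functions -/

section TestFunctions

/-! Upper bound. Since `f ≥ 0` is not identically zero, `∫ f η` stays above a fixed `m > 0` for
every cutoff `η` equal to `1` away from a thin boundary layer. If `α > 1`, then `∇u = 0` in `Ω`, and
testing with `η` gives `∫ f η = 0`, a contradiction (`holder_exponent_le_one`). If `β > 0` and `α +
β > 1`, let `η` have its gradient, of size `1/s`, in the layer of width `s`. There `|u| ≤ H s^α`,
because `u` vanishes on the boundary. Young's inequality bounds `∇u · ∇η` by `s^{-α} |∇u|²` plus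
`s^α |∇η|²`; the first term is absorbed by testing with `ζ² u` (Caccioppoli), where `ζ = 1` wherever
`∇η ≠ 0`. As `d^β ≤ s^β` and the layer has volume `O(s)`, the result is `m ≤ const · (s^{α+β-1} +
s)`, absurd as `s → 0` (`holder_exponent_add_le_one`). The ingredients are the volume bound
`exists_measureReal_thickening_le`, the cutoffs `exists_cutoffs`, and the extension to `C¹` test
functions `SolvesEquation.of_contDiff_one`, needed because `ζ² u` is not smooth.

Sharpness. For radial `u = g(|x|)` the flux is `d^β ∇u = -w(|x|) x`, and the equation becomes `r w'
+ N w = f`. Both examples fit this scheme (`IsRadialProfile`): `w = 1/N` for `f = 1`, and `w(r) =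
r^{-N} ∫_0^r t^{N-1} (1-t)^β dt` for `f = d^β`. Since `0 < w ≤ 1`, the increments of `g` are
dominated by those of `(1-r)^{1-β}/(1-β)`, which gives the Hölder regularity; the converse
implication is the upper bound itself. -/

theorem ContinuousOn.continuous_mul_of_tsupport_subset {E : Type*} [TopologicalSpace E]
    {Ω : Set E} (hΩ : IsOpen Ω) {a φ : E → ℝ}
    (ha : ContinuousOn a Ω) (hφ : Continuous φ) (hsub : tsupport φ ⊆ Ω) :
    Continuous fun x => a x * φ x := by
  refine continuous_of_tsupport fun x hx => ?_
  have hx' : x ∈ Ω := hsub (closure_mono (Function.support_mul_subset_right _ _) hx)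
  exact (ha.continuousAt (hΩ.mem_nhds hx')).mul hφ.continuousAt

variable {E : Type*} [NormedAddCommGroup E] [InnerProductSpace ℝ E] [FiniteDimensional ℝ E]
  [MeasurableSpace E] [BorelSpace E]

theorem ContinuousOn.integrable_mul_of_tsupport_subset {Ω : Set E} (hΩ : IsOpen Ω) {a φ : E → ℝ}
    (ha : ContinuousOn a Ω) (hφ : Continuous φ) (hc : HasCompactSupport φ)
    (hsub : tsupport φ ⊆ Ω) : Integrable (fun x => a x * φ x) (volume : Measure E) :=
  (ha.continuous_mul_of_tsupport_subset hΩ hφ hsub).integrable_of_hasCompactSupport hc.mul_left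

/-- The divergence theorem for a vector field `W` of class `C¹` in an open set, tested against a
compactly supported function. -/
theorem integral_inner_gradient_eq_neg_integral_div {Ω : Set E} (hΩ : IsOpen Ω) {W : E → E}
    (hW : ContDiffOn ℝ 1 W Ω) {φ : E → ℝ} (hφ : ContDiff ℝ 1 φ) (hc : HasCompactSupport φ)
    (hsub : tsupport φ ⊆ Ω) {ι : Type*} [Fintype ι] (b : OrthonormalBasis ι ℝ E) :
    ∫ x in Ω, inner ℝ (W x) (gradient φ x) =
      -∫ x in Ω, (∑ i, inner ℝ (b i) (fderiv ℝ W x (b i))) * φ x := by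
  have hφd : Differentiable ℝ φ := hφ.differentiable one_ne_zero
  have hWd : ∀ x ∈ Ω, HasFDerivAt W (fderiv ℝ W x) x := fun x hx =>
    ((hW.differentiableOn one_ne_zero).differentiableAt (hΩ.mem_nhds hx)).hasFDerivAt
  have hW' : ContinuousOn (fderiv ℝ W) Ω := hW.continuousOn_fderiv_of_isOpen hΩ le_rfl
  have hdφ : Continuous (fderiv ℝ φ) := hφ.continuous_fderiv one_ne_zero
  have hts : ∀ v, tsupport (fun x => fderiv ℝ φ x v) ⊆ tsupport φ := fun v =>
    (closure_mono fun x hx => by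
      contrapose! hx
      simp only [Function.mem_support, not_not] at hx ⊢
      simp [hx]).trans (tsupport_fderiv_subset ℝ (f := φ))
  have hi1 : ∀ i, Integrable (fun x => inner ℝ (b i) (fderiv ℝ W x (b i)) * φ x)
      (volume : Measure E) := fun i =>
    ContinuousOn.integrable_mul_of_tsupport_subset hΩ
      (continuousOn_const.inner (hW'.clm_apply continuousOn_const)) hφ.continuous hc hsub
  have hi2 : ∀ i, Integrable (fun x => inner ℝ (b i) (W x) * fderiv ℝ φ x (b i))
      (volume : Measure E) := fun i =>
    ContinuousOn.integrable_mul_of_tsupport_subset hΩ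
      (continuousOn_const.inner hW.continuousOn) (hdφ.clm_apply continuous_const)
      (hc.of_isClosed_subset (isClosed_tsupport _) (hts _)) ((hts _).trans hsub)
  have hi3 : ∀ i, Integrable (fun x => inner ℝ (b i) (W x) * φ x) (volume : Measure E) := fun i =>
    ContinuousOn.integrable_mul_of_tsupport_subset hΩ
      (continuousOn_const.inner hW.continuousOn) hφ.continuous hc hsub
  have key : ∀ i, ∫ x, inner ℝ (b i) (W x) * fderiv ℝ φ x (b i) =
      -∫ x, inner ℝ (b i) (fderiv ℝ W x (b i)) * φ x := by
    intro i
    refine integral_bilinear_hasLineDerivAt_right_eq_neg_left_of_integrable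
      (B := ContinuousLinearMap.mul ℝ ℝ) (v := b i) (hi1 i) (hi2 i) (hi3 i) ?_ ?_
    · intro x hx
      have := ((innerSL ℝ (b i)).hasFDerivAt.comp x (hWd x (hsub hx))).hasLineDerivAt (b i)
      simpa [Function.comp_def] using this
    · intro x _
      exact (hφd x).hasFDerivAt.hasLineDerivAt (b i)
  have e1 : ∀ x, inner ℝ (W x) (gradient φ x) =
      ∑ i, inner ℝ (b i) (W x) * fderiv ℝ φ x (b i) := by
    intro x
    rw [← b.sum_inner_mul_inner (W x) (gradient φ x)]
    refine Finset.sum_congr rfl fun i _ => ?_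
    rw [real_inner_comm (b i) (W x), real_inner_comm (gradient φ x) (b i), inner_gradient_left]
  have z1 : ∀ x, x ∉ Ω → inner ℝ (W x) (gradient φ x) = 0 := by
    intro x hx
    have : fderiv ℝ φ x = 0 := by
      by_contra h
      exact hx (hsub (tsupport_fderiv_subset ℝ (f := φ) (subset_closure h)))
    rw [e1]; simp [this]
  have z2 : ∀ x, x ∉ Ω → (∑ i, inner ℝ (b i) (fderiv ℝ W x (b i))) * φ x = 0 := by
    intro x hx
    rw [image_eq_zero_of_notMem_tsupport fun h => hx (hsub h), mul_zero]
  rw [setIntegral_eq_integral_of_forall_compl_eq_zero z1,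
    setIntegral_eq_integral_of_forall_compl_eq_zero z2]
  simp_rw [e1, Finset.sum_mul]
  rw [integral_finsetSum _ fun i _ => hi2 i, integral_finsetSum _ fun i _ => hi1 i,
    ← Finset.sum_neg_distrib]
  exact Finset.sum_congr rfl fun i _ => key i

end TestFunctions

/-! ### Calculus of radial functions and radial vector fields, including at the origin -/

section RadialFields

variable {E : Type*} [NormedAddCommGroup E] [InnerProductSpace ℝ E]

/-- The derivative of the radial field `x ↦ k(‖x‖) x`, where `p(r) = r k'(r)`. -/
noncomputable def radialFieldDeriv (k p : ℝ → ℝ) (x : E) : E →L[ℝ] E :=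
  k ‖x‖ • ContinuousLinearMap.id ℝ E + (p ‖x‖ / ‖x‖ ^ 2) • (innerSL ℝ x).smulRight x

theorem hasFDerivAt_norm_of_ne_zero {x : E} (hx : x ≠ 0) :
    HasFDerivAt (fun y : E => ‖y‖) (‖x‖⁻¹ • innerSL ℝ x) x := by
  have hpos : 0 < ‖x‖ := norm_pos_iff.2 hx
  have h1 : HasFDerivAt (fun y : E => ‖y‖ ^ 2) (2 • innerSL ℝ x) x := by
    simpa using (hasStrictFDerivAt_norm_sq x).hasFDerivAt
  have h2 := h1.sqrt (by positivity)
  have h3 : (fun y : E => √(‖y‖ ^ 2)) = fun y => ‖y‖ := by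
    ext y; exact Real.sqrt_sq (norm_nonneg y)
  rw [h3, Real.sqrt_sq hpos.le] at h2
  convert! h2 using 1
  ext y; simp; field_simp

theorem continuousAt_comp_norm {E : Type*} [NormedAddCommGroup E] {k : ℝ → ℝ}
    (hk : ContinuousOn k (Ico 0 1)) {x : E} (hx : ‖x‖ < 1) :
    ContinuousAt (fun y : E => k ‖y‖) x := by
  have h1 : ContinuousOn (fun y : E => k ‖y‖) (Metric.ball 0 1) :=
    hk.comp continuous_norm.continuousOn fun y hy =>
      ⟨norm_nonneg y, by simpa using hy⟩
  exact h1.continuousAt (Metric.isOpen_ball.mem_nhds (by simpa using hx))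

/-- Writing `k' = p / r` keeps the origin harmless: there only continuity of `k` is needed, because
`k(|y|) y = k(0) y + o(|y|)`. -/
theorem hasFDerivAt_radialField {k p : ℝ → ℝ} (hk : ContinuousOn k (Ico 0 1))
    (hkp : ∀ r ∈ Ioo (0 : ℝ) 1, HasDerivAt k (p r / r) r) {x : E} (hx : ‖x‖ < 1) :
    HasFDerivAt (fun y : E => k ‖y‖ • y) (radialFieldDeriv k p x) x := by
  rcases eq_or_ne x 0 with rfl | hx0
  · have : radialFieldDeriv k p (0 : E) = k 0 • ContinuousLinearMap.id ℝ E := by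
      simp [radialFieldDeriv]
    rw [this, hasFDerivAt_iff_isLittleO_nhds_zero]
    have h := continuousAt_comp_norm hk hx
    have h0 : (fun y : E => k ‖y‖ - k 0) =o[𝓝 0] (fun _ => (1 : ℝ)) := by
      rw [Asymptotics.isLittleO_one_iff]
      have := h.tendsto.sub_const (k 0)
      simpa using this
    have := h0.smul_isBigO (Asymptotics.isBigO_refl (fun y : E => y) (𝓝 0))
    simpa [sub_smul] using this
  · have hpos : 0 < ‖x‖ := norm_pos_iff.2 hx0
    have hn := hasFDerivAt_norm_of_ne_zero hx0
    have h1 : HasFDerivAt (fun y : E => k ‖y‖) ((p ‖x‖ / ‖x‖) • (‖x‖⁻¹ • innerSL ℝ x)) x :=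
      (hkp ‖x‖ ⟨hpos, hx⟩).comp_hasFDerivAt x hn
    convert! h1.smul (hasFDerivAt_id x) using 1
    ext y
    simp [radialFieldDeriv, smul_smul]
    congr 1
    field_simp

/-- The rank-one term of the derivative has norm at most `|p(|y|)|`, so `p 0 = 0` makes it vanish
continuously at the origin. -/
theorem continuousOn_radialFieldDeriv {k p : ℝ → ℝ} (hk : ContinuousOn k (Ico 0 1))
    (hp : ContinuousOn p (Ico 0 1)) (hp0 : p 0 = 0) :
    ContinuousOn (radialFieldDeriv k p : E → E →L[ℝ] E) (Metric.ball 0 1) := by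
  intro x hx
  have hx1 : ‖x‖ < 1 := by simpa using hx
  refine ContinuousAt.continuousWithinAt ?_
  refine ((continuousAt_comp_norm hk hx1).smul continuousAt_const).add ?_
  have hp' := continuousAt_comp_norm (E := E) hp hx1
  have hs : Continuous fun y : E => (innerSL ℝ y).smulRight y := by fun_prop
  rcases eq_or_ne x 0 with rfl | hx0
  · have hbound : ∀ y : E, ‖(p ‖y‖ / ‖y‖ ^ 2) • (innerSL ℝ y).smulRight y‖ ≤ ‖p ‖y‖‖ := by
      intro y
      rcases eq_or_ne y 0 with rfl | hy
      · simp
      have : 0 < ‖y‖ := norm_pos_iff.2 hy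
      rw [norm_smul, ContinuousLinearMap.norm_smulRight_apply, innerSL_apply_norm, norm_div,
        norm_pow, norm_norm]
      apply le_of_eq
      field_simp
    have : Tendsto (fun y : E => ‖p ‖y‖‖) (𝓝 0) (𝓝 0) := by
      have := hp'.norm.tendsto
      simpa [hp0] using this
    have h2 := squeeze_zero_norm hbound this
    unfold ContinuousAt
    simpa using h2
  · exact (hp'.div (by fun_prop) (by simpa using hx0)).smul hs.continuousAt

theorem contDiffOn_radialField {k p : ℝ → ℝ} (hk : ContinuousOn k (Ico 0 1))
    (hp : ContinuousOn p (Ico 0 1)) (hp0 : p 0 = 0)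
    (hkp : ∀ r ∈ Ioo (0 : ℝ) 1, HasDerivAt k (p r / r) r) :
    ContDiffOn ℝ 1 (fun y : E => k ‖y‖ • y) (Metric.ball 0 1) := by
  have h : (1 : WithTop ℕ∞) = 0 + 1 := by simp
  have hd : ∀ x ∈ Metric.ball (0 : E) 1,
      HasFDerivAt (fun y : E => k ‖y‖ • y) (radialFieldDeriv k p x) x := fun x hx =>
    hasFDerivAt_radialField hk hkp (by simpa using hx)
  rw [h, contDiffOn_succ_iff_fderiv_of_isOpen Metric.isOpen_ball]
  refine ⟨fun x hx => (hd x hx).differentiableAt.differentiableWithinAt, by simp, ?_⟩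
  rw [contDiffOn_zero]
  exact (continuousOn_radialFieldDeriv hk hp hp0).congr fun x hx => (hd x hx).fderiv

theorem sum_inner_radialFieldDeriv {ι : Type*} [Fintype ι] (b : OrthonormalBasis ι ℝ E)
    {k p : ℝ → ℝ} (hp0 : p 0 = 0) (x : E) :
    ∑ i, inner ℝ (b i) (radialFieldDeriv k p x (b i)) = Fintype.card ι * k ‖x‖ + p ‖x‖ := by
  have h1 : ∀ i, inner ℝ (b i) (radialFieldDeriv k p x (b i)) =
      k ‖x‖ + p ‖x‖ / ‖x‖ ^ 2 * (inner ℝ x (b i) * inner ℝ (b i) x) := by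
    intro i
    simp [radialFieldDeriv, inner_add_right, inner_smul_right]
  simp_rw [h1]
  rw [Finset.sum_add_distrib, ← Finset.mul_sum, b.sum_inner_mul_inner]
  simp only [Finset.sum_const, Finset.card_univ, nsmul_eq_mul, real_inner_self_eq_norm_sq]
  rcases eq_or_ne x 0 with rfl | hx
  · simp [hp0]
  · have : ‖x‖ ≠ 0 := norm_ne_zero_iff.2 hx
    field_simp

/-- A radial function `g(‖x‖)` with `g'(r) = r q(r)` has gradient `q(‖x‖) x`. -/
theorem hasGradientAt_radial [CompleteSpace E] {g q : ℝ → ℝ}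
    (hg : ∀ r ∈ Ico (0 : ℝ) 1, HasDerivWithinAt g (r * q r) (Ici 0) r) {x : E} (hx : ‖x‖ < 1) :
    HasGradientAt (fun y : E => g ‖y‖) (q ‖x‖ • x) x := by
  rw [hasGradientAt_iff_isLittleO]
  rcases eq_or_ne x 0 with rfl | hx0
  · have h := (hasDerivWithinAt_iff_isLittleO.1 (hg 0 ⟨le_rfl, one_pos⟩))
    have ht : Tendsto (fun y : E => ‖y‖) (𝓝 0) (𝓝[≥] 0) :=
      tendsto_nhdsWithin_iff.2 ⟨by simpa using (continuous_norm (E := E)).tendsto 0,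
        Eventually.of_forall fun y => norm_nonneg y⟩
    have := h.comp_tendsto ht
    simp only [Function.comp_def, sub_zero, zero_mul, smul_zero] at this
    exact (by simpa using this : (fun y : E => g ‖y‖ - g ‖(0 : E)‖ - inner ℝ (q ‖(0 : E)‖ • (0 : E)) (y - 0)) =o[𝓝 (0 : E)] fun y : E => ‖y‖).of_norm_right.trans_eventuallyEq (.of_forall fun y => (sub_zero y).symm)
  · have hpos : 0 < ‖x‖ := norm_pos_iff.2 hx0
    rw [← hasGradientAt_iff_isLittleO, hasGradientAt_iff_hasFDerivAt]
    have hn := hasFDerivAt_norm_of_ne_zero hx0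
    have h1 : HasDerivAt g (‖x‖ * q ‖x‖) ‖x‖ :=
      (hg ‖x‖ ⟨hpos.le, hx⟩).hasDerivAt (Ici_mem_nhds hpos)
    convert! h1.comp_hasFDerivAt x hn using 1
    ext y
    simp
    field_simp

end RadialFields

/-! ### The unit ball and radial solutions on it -/

section UnitBall

variable {N : ℕ}

theorem frontier_unitBall : frontier (unitBall N) = Metric.sphere 0 1 :=
  frontier_ball 0 one_ne_zero

theorem closure_unitBall : closure (unitBall N) = Metric.closedBall 0 1 :=
  closure_ball 0 one_ne_zero

theorem mem_unitBall {x : EuclideanSpace ℝ (Fin N)} : x ∈ unitBall N ↔ ‖x‖ < 1 := by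
  simp [unitBall]

theorem nontrivial_euclideanSpace (hN : 2 ≤ N) : Nontrivial (EuclideanSpace ℝ (Fin N)) := by
  have : Nonempty (Fin N) := ⟨⟨0, by omega⟩⟩
  infer_instance

theorem bdryDist_unitBall (hN : 2 ≤ N) {x : EuclideanSpace ℝ (Fin N)} (hx : ‖x‖ ≤ 1) :
    bdryDist (unitBall N) x = 1 - ‖x‖ := by
  have := nontrivial_euclideanSpace hN
  have hne : (Metric.sphere (0 : EuclideanSpace ℝ (Fin N)) 1).Nonempty :=
    NormedSpace.sphere_nonempty.2 zero_le_one
  rw [bdryDist, frontier_unitBall]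
  apply le_antisymm
  · rcases eq_or_ne x 0 with rfl | hx0
    · obtain ⟨z, hz⟩ := hne
      refine (Metric.infDist_le_dist_of_mem hz).trans ?_
      have : ‖z‖ = 1 := by simpa using hz
      simp [this]
    · have hpos : 0 < ‖x‖ := norm_pos_iff.2 hx0
      have hz : ‖x‖⁻¹ • x ∈ Metric.sphere (0 : EuclideanSpace ℝ (Fin N)) 1 := by
        simp [norm_smul, hpos.ne']
      refine (Metric.infDist_le_dist_of_mem hz).trans (le_of_eq ?_)
      rw [dist_eq_norm]
      have : x - ‖x‖⁻¹ • x = (1 - ‖x‖⁻¹) • x := by rw [sub_smul, one_smul]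
      rw [this, norm_smul, Real.norm_eq_abs, abs_of_nonpos]
      · field_simp; ring
      · have := (one_le_inv₀ hpos).2 hx
        linarith
  · refine (Metric.le_infDist hne).2 fun z hz => ?_
    have : ‖z‖ = 1 := by simpa using hz
    rw [dist_eq_norm, ← this, norm_sub_rev]
    exact norm_sub_norm_le z x

theorem isBoundedC2Domain_unitBall : IsBoundedC2Domain (unitBall N) where
  isOpen := Metric.isOpen_ball
  isConnected := ⟨⟨0, by simp [mem_unitBall]⟩, (convex_ball 0 1).isPreconnected⟩
  isBounded := Metric.isBounded_ball
  boundary := by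
    intro x₀ hx₀
    rw [frontier_unitBall] at hx₀
    refine ⟨{0}ᶜ, fun x => 1 - ‖x‖ ^ 2, isOpen_compl_singleton, ?_, ?_, ?_, ?_⟩
    · rintro rfl
      simp at hx₀
    · exact (contDiff_const.sub (contDiff_norm_sq ℝ)).contDiffOn
    · intro x hx h
      have h1 : HasFDerivAt (fun x : EuclideanSpace ℝ (Fin N) => 1 - ‖x‖ ^ 2)
          (-(2 • innerSL ℝ x)) x := by
        simpa using ((hasStrictFDerivAt_norm_sq x).hasFDerivAt).const_sub 1
      rw [h1.fderiv] at h
      have := congrArg (fun L => L x) h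
      simp at this
      exact hx this
    · ext x
      simp only [mem_inter_iff, mem_unitBall, mem_compl_iff, mem_singleton_iff, mem_ofPred_eq]
      rw [and_comm]
      refine and_congr_right fun _ => ?_
      rw [sub_pos, sq_lt_one_iff₀ (norm_nonneg x)]

theorem isSource_rpow_bdryDist_unitBall (hN : 2 ≤ N) {β : ℝ} (hβ : 0 ≤ β) :
    IsSource (unitBall N) (fun x => bdryDist (unitBall N) x ^ β) where
  continuousOn := ((Metric.continuous_infDist_pt _).rpow_const fun _ => .inr hβ).continuousOn
  nonneg := fun x _ => Real.rpow_nonneg Metric.infDist_nonneg β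
  ne_zero := ⟨0, by simp [mem_unitBall], by rw [bdryDist_unitBall hN (by simp)]; simp⟩

theorem isSource_one : IsSource (unitBall N) (fun _ => 1) where
  continuousOn := continuousOn_const
  nonneg := fun _ _ => zero_le_one
  ne_zero := ⟨0, by simp [mem_unitBall], one_ne_zero⟩

/-- `x ↦ g(‖x‖)` solves the problem with right-hand side `f(‖x‖)` in the unit ball of dimension `n`,
where `w = -r⁻¹ (1-r)^β g'`. -/
structure IsRadialProfile (n β : ℝ) (f g w : ℝ → ℝ) : Prop where
  continuousOn : ContinuousOn g (Icc 0 1)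
  eq_zero : g 1 = 0
  hasDeriv : ∀ r ∈ Ico (0 : ℝ) 1, HasDerivWithinAt g (r * -((1 - r) ^ (-β) * w r)) (Ici 0) r
  flux_continuousOn : ContinuousOn w (Ico 0 1)
  source_continuousOn : ContinuousOn f (Ico 0 1)
  flux_hasDeriv : ∀ r ∈ Ioo (0 : ℝ) 1, HasDerivAt w ((f r - n * w r) / r) r
  flux_zero : n * w 0 = f 0
  flux_pos : ∀ r ∈ Ioo (0 : ℝ) 1, 0 < w r
  flux_le : ∀ r ∈ Ioo (0 : ℝ) 1, w r ≤ 1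

namespace IsRadialProfile

variable {β : ℝ} {f g w : ℝ → ℝ}

theorem hasDerivAt {n : ℝ} (h : IsRadialProfile n β f g w) {r : ℝ} (hr : r ∈ Ioo (0 : ℝ) 1) :
    HasDerivAt g (r * -((1 - r) ^ (-β) * w r)) r :=
  (h.hasDeriv r ⟨hr.1.le, hr.2⟩).hasDerivAt (Ici_mem_nhds hr.1)

/-- Both `∇u` and the flux `d^β ∇u` are radial fields `k(|x|) x`. The first being `C¹` gives `u ∈
C²`; the divergence of the second is `-(N w + r w') = -f`. -/
theorem isSolution (hN : 2 ≤ N) (h : IsRadialProfile N β f g w)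
    {F u : EuclideanSpace ℝ (Fin N) → ℝ} (hF : ∀ x, ‖x‖ < 1 → F x = f ‖x‖)
    (hu : ∀ x, ‖x‖ ≤ 1 → u x = g ‖x‖) : IsSolution (unitBall N) β F u := by
  have hΩ : IsOpen (unitBall N) := Metric.isOpen_ball
  have hgrad : ∀ x, ‖x‖ < 1 → HasGradientAt u (-((1 - ‖x‖) ^ (-β) * w ‖x‖) • x) x := by
    intro x hx
    refine (hasGradientAt_radial (q := fun r => -((1 - r) ^ (-β) * w r))
      h.hasDeriv hx).congr_of_eventuallyEq ?_
    filter_upwards [hΩ.mem_nhds (mem_unitBall.2 hx)] with y hy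
    exact hu y (mem_unitBall.1 hy).le
  have hsub : ∀ r ∈ Ico (0 : ℝ) 1, 1 - r ≠ 0 := fun r hr => (sub_pos.2 hr.2).ne'
  have hpow : ∀ s : ℝ, ContinuousOn (fun r : ℝ => (1 - r) ^ s) (Ico 0 1) := fun s =>
    (by fun_prop : Continuous fun r : ℝ => 1 - r).continuousOn.rpow_const fun r hr =>
      .inl (hsub r hr)
  have hqC1 : ContDiffOn ℝ 1
      (fun x : EuclideanSpace ℝ (Fin N) => -((1 - ‖x‖) ^ (-β) * w ‖x‖) • x)
      (Metric.ball 0 1) := by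
    -- Here `p = r k'`, with `r w'` replaced by `f - N w`; this expression makes sense at `r = 0`,
    -- where `flux_zero` says that it vanishes.
    refine contDiffOn_radialField (k := fun r => -((1 - r) ^ (-β) * w r))
      (p := fun r => -(β * (1 - r) ^ (-β - 1) * r * w r + (1 - r) ^ (-β) * (f r - N * w r)))
      ((hpow _).mul h.flux_continuousOn).neg ?_ ?_ ?_
    · exact ((((continuousOn_const.mul (hpow _)).mul continuousOn_id).mul
        h.flux_continuousOn).add ((hpow _).mul
          (h.source_continuousOn.sub (continuousOn_const.mul h.flux_continuousOn)))).neg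
    · simp [h.flux_zero]
    · intro r hr
      have h1 : HasDerivAt (fun r : ℝ => (1 - r) ^ (-β)) (-1 * -β * (1 - r) ^ (-β - 1)) r :=
        ((hasDerivAt_id r).const_sub 1).rpow_const (.inl (hsub r ⟨hr.1.le, hr.2⟩))
      convert! (h1.mul (h.flux_hasDeriv r hr)).neg using 1
      have := hr.1.ne'
      field_simp
  have hWC1 : ContDiffOn ℝ 1 (fun x : EuclideanSpace ℝ (Fin N) => (-w ‖x‖) • x)
      (Metric.ball 0 1) ∧ ∀ x : EuclideanSpace ℝ (Fin N), ‖x‖ < 1 →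
        HasFDerivAt (fun x => (-w ‖x‖) • x)
          (radialFieldDeriv (fun r => -w r) (fun r => -(f r - N * w r)) x) x := by
    have hd : ∀ r ∈ Ioo (0 : ℝ) 1, HasDerivAt (fun r => -w r) (-(f r - N * w r) / r) r := by
      intro r hr
      convert! (h.flux_hasDeriv r hr).neg using 1
      ring
    refine ⟨contDiffOn_radialField (k := fun r => -w r) (p := fun r => -(f r - N * w r))
      h.flux_continuousOn.neg ?_ (by simp [h.flux_zero]) hd, fun x hx =>
      hasFDerivAt_radialField (k := fun r => -w r) h.flux_continuousOn.neg hd hx⟩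
    exact (h.source_continuousOn.sub (continuousOn_const.mul h.flux_continuousOn)).neg
  refine ⟨?_, ?_, ?_, ?_⟩
  · have e : (2 : WithTop ℕ∞) = 1 + 1 := by norm_num
    rw [e, contDiffOn_succ_iff_fderiv_of_isOpen hΩ]
    refine ⟨fun x hx => (hgrad x (mem_unitBall.1 hx)).differentiableAt.differentiableWithinAt,
      by simp, ?_⟩
    refine ((innerSL ℝ (E := EuclideanSpace ℝ (Fin N))).contDiff.comp_contDiffOn hqC1).congr ?_
    intro x hx
    have := (hasGradientAt_iff_hasFDerivAt.1 (hgrad x (mem_unitBall.1 hx))).fderiv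
    rw [this]
    ext y
    exact (innerSL_apply_apply ℝ _ y).symm
  · rw [closure_unitBall]
    refine (h.continuousOn.comp continuous_norm.continuousOn fun x hx => ?_).congr fun x hx =>
      hu x (by simpa using hx)
    exact ⟨norm_nonneg x, by simpa using hx⟩
  · intro φ hφ hc hs
    have := integral_inner_gradient_eq_neg_integral_div hΩ hWC1.1 (hφ.of_le (by simp)) hc hs
      (EuclideanSpace.basisFun (Fin N) ℝ)
    rw [← neg_neg (∫ x in unitBall N, F x * φ x), ← integral_neg]
    calc _ = ∫ x in unitBall N, inner ℝ ((-w ‖x‖) • x) (gradient φ x) := by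
          refine setIntegral_congr_fun hΩ.measurableSet fun x hx => ?_
          have hx1 := mem_unitBall.1 hx
          have hp : 0 < 1 - ‖x‖ := by linarith
          simp only [(hgrad x hx1).gradient, bdryDist_unitBall hN hx1.le, real_inner_smul_left]
          have : (1 - ‖x‖) ^ β * (1 - ‖x‖) ^ (-β) = 1 := by
            rw [← Real.rpow_add hp]; simp
          linear_combination -(w ‖x‖ * inner ℝ x (gradient φ x)) * this
      _ = _ := this
      _ = _ := by
          congr 1
          refine setIntegral_congr_fun hΩ.measurableSet fun x hx => ?_
          have hx1 := mem_unitBall.1 hx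
          simp only [(hWC1.2 x hx1).fderiv]
          rw [sum_inner_radialFieldDeriv _ (by simp [h.flux_zero]), hF x hx1]
          simp only [Fintype.card_fin]
          ring
  · intro x hx
    rw [frontier_unitBall] at hx
    have hx : ‖x‖ = 1 := by simpa using hx
    rw [hu x hx.le, hx, h.eq_zero]

theorem strictAntiOn {n : ℝ} (h : IsRadialProfile n β f g w) : StrictAntiOn g (Icc 0 1) := by
  refine strictAntiOn_of_deriv_neg (convex_Icc 0 1) h.continuousOn fun r hr => ?_
  rw [interior_Icc] at hr
  rw [(h.hasDerivAt hr).deriv, mul_neg, neg_lt_zero]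
  have : 0 < 1 - r := sub_pos.2 hr.2
  have := h.flux_pos r hr
  have := hr.1
  positivity

theorem pos {n : ℝ} (h : IsRadialProfile n β f g w) {r : ℝ} (hr : r ∈ Ico (0 : ℝ) 1) : 0 < g r := by
  have := h.strictAntiOn ⟨hr.1, hr.2.le⟩ ⟨zero_le_one, le_rfl⟩ hr.2
  rwa [h.eq_zero] at this

end IsRadialProfile

/-- Subadditivity of `t ↦ t^p` for `p ≤ 1`; Bernoulli's inequality at `y / x` for `p ≥ 1`. -/
theorem Real.rpow_sub_rpow_le_of_le_one {p x y : ℝ} (hp : 0 < p) (hy : 0 ≤ y) (hyx : y ≤ x)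
    (hx : x ≤ 1) : x ^ p - y ^ p ≤ max 1 p * (x - y) ^ min 1 p := by
  rcases le_total p 1 with h | h
  · rw [max_eq_left h, min_eq_right h, one_mul]
    have := Real.rpow_add_le_add_rpow hy (sub_nonneg.2 hyx) hp.le h
    rw [add_sub_cancel] at this
    linarith
  · rw [max_eq_right h, min_eq_left h, Real.rpow_one]
    rcases eq_or_lt_of_le (hy.trans hyx) with hx0 | hx0
    · have : y = 0 := le_antisymm (hyx.trans hx0.symm.le) hy
      simp [← hx0, this]
    have h1 := one_add_mul_self_le_rpow_one_add (s := y / x - 1)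
      (by have := div_nonneg hy hx0.le; linarith) h
    rw [add_sub_cancel, Real.div_rpow hy hx0.le, le_div_iff₀ (by positivity)] at h1
    have h2 : x ^ p ≤ x := by
      simpa using Real.rpow_le_rpow_of_exponent_ge hx0 hx h
    have h3 : p * (1 - y / x) * x ^ p ≤ p * (1 - y / x) * x := by
      have : y / x ≤ 1 := (div_le_one hx0).2 hyx
      gcongr
    have h4 : p * (1 - y / x) * x = p * (x - y) := by field_simp
    nlinarith

namespace IsRadialProfile

variable {β : ℝ} {f g w : ℝ → ℝ}

/-- The function `g - (1-r)^{1-β}/(1-β)` has derivative `(1-r)^{-β} (1 - r w)`, nonnegative because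
`w ≤ 1`. So `g` falls no faster than the explicit power, whose modulus of continuity is known. -/
theorem sub_le {n : ℝ} (hβ : β < 1) (h : IsRadialProfile n β f g w) {a b : ℝ} (ha : 0 ≤ a)
    (hab : a ≤ b) (hb : b ≤ 1) :
    g a - g b ≤ max 1 (1 - β) / (1 - β) * (b - a) ^ min 1 (1 - β) := by
  have hp : 0 < 1 - β := sub_pos.2 hβ
  have hmono : MonotoneOn (fun r => g r - (1 - r) ^ (1 - β) / (1 - β)) (Icc 0 1) := by
    have hd : ∀ r ∈ Ioo (0 : ℝ) 1, HasDerivAt (fun r => g r - (1 - r) ^ (1 - β) / (1 - β))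
        ((1 - r) ^ (-β) * (1 - r * w r)) r := by
      intro r hr
      have h1 : HasDerivAt (fun r : ℝ => (1 - r) ^ (1 - β))
          (-1 * (1 - β) * (1 - r) ^ (1 - β - 1)) r :=
        ((hasDerivAt_id r).const_sub 1).rpow_const (.inl (sub_pos.2 hr.2).ne')
      convert! (h.hasDerivAt hr).sub (h1.div_const (1 - β)) using 1
      rw [show 1 - β - 1 = -β by ring]
      field_simp
      ring
    refine monotoneOn_of_deriv_nonneg (convex_Icc 0 1) ?_ ?_ ?_
    · refine h.continuousOn.sub (ContinuousOn.div_const ?_ _)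
      exact ((by fun_prop : Continuous fun r : ℝ => 1 - r).rpow_const
        fun _ => .inr hp.le).continuousOn
    · rw [interior_Icc]
      exact fun r hr => (hd r hr).differentiableAt.differentiableWithinAt
    · rw [interior_Icc]
      intro r hr
      rw [(hd r hr).deriv]
      have := h.flux_le r hr
      have := h.flux_pos r hr
      exact mul_nonneg (Real.rpow_nonneg (sub_pos.2 hr.2).le _) (by nlinarith [hr.1, hr.2])
  have h1 := hmono ⟨ha, hab.trans hb⟩ ⟨ha.trans hab, hb⟩ hab
  have h2 := Real.rpow_sub_rpow_le_of_le_one hp (sub_nonneg.2 hb)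
    (by linarith : 1 - b ≤ 1 - a) (by linarith)
  rw [show 1 - a - (1 - b) = b - a by ring] at h2
  have h3 := div_le_div_of_nonneg_right h2 hp.le
  simp only at h1
  rw [sub_div] at h3
  have : max 1 (1 - β) * (b - a) ^ min 1 (1 - β) / (1 - β) =
    max 1 (1 - β) / (1 - β) * (b - a) ^ min 1 (1 - β) := by ring
  linarith

theorem isHolderUpToBoundary {n : ℝ} (hβ : β < 1) (h : IsRadialProfile n β f g w)
    {u : EuclideanSpace ℝ (Fin N) → ℝ} (hu : ∀ x, ‖x‖ ≤ 1 → u x = g ‖x‖) {α : ℝ≥0}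
    (hα : (α : ℝ) ≤ min 1 (1 - β)) : IsHolderUpToBoundary (unitBall N) α u := by
  have hp : 0 < 1 - β := sub_pos.2 hβ
  set C : ℝ≥0 := ⟨max 1 (1 - β) / (1 - β), by positivity⟩ with hC
  have hCv : (C : ℝ) = max 1 (1 - β) / (1 - β) := rfl
  have key : ∀ x y : EuclideanSpace ℝ (Fin N), ‖x‖ ≤ 1 → ‖y‖ ≤ 1 → ‖x‖ ≤ ‖y‖ →
      dist (u x) (u y) ≤ C * dist x y ^ (α : ℝ) := by
    intro x y hx hy hxy
    have h0 : ‖y‖ - ‖x‖ ≤ dist x y := by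
      rw [dist_eq_norm, norm_sub_rev]; exact norm_sub_norm_le y x
    rw [hu x hx, hu y hy, Real.dist_eq, abs_of_nonneg (sub_nonneg.2 (h.strictAntiOn.antitoneOn
      ⟨norm_nonneg x, hx⟩ ⟨norm_nonneg y, hy⟩ hxy))]
    refine (h.sub_le hβ (norm_nonneg x) hxy hy).trans ?_
    rw [hCv]
    gcongr
    -- The radii differ by at most `1`, so lowering the exponent to `α` only increases the power.
    refine (Real.rpow_le_rpow_of_exponent_ge' (sub_nonneg.2 hxy)
      (by linarith [norm_nonneg x]) α.coe_nonneg hα).trans ?_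
    exact Real.rpow_le_rpow (sub_nonneg.2 hxy) h0 α.coe_nonneg
  refine ⟨C, fun x hx y hy => ?_⟩
  rw [closure_unitBall, mem_closedBall_zero_iff] at hx hy
  have key' : dist (u x) (u y) ≤ C * dist x y ^ (α : ℝ) := by
    rcases le_total ‖x‖ ‖y‖ with hxy | hxy
    · exact key x y hx hy hxy
    · rw [dist_comm (u x), dist_comm x]; exact key y x hy hx hxy
  rw [edist_dist, edist_dist, ENNReal.ofReal_rpow_of_nonneg dist_nonneg α.coe_nonneg,
    ← ENNReal.ofReal_coe_nnreal, ← ENNReal.ofReal_mul C.coe_nonneg]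
  exact ENNReal.ofReal_le_ofReal key'

/-- The ratio of the profile and `(1-r)^{1-β}` has a limit at the boundary, if the flux has. -/
theorem tendsto_div_rpow {n c : ℝ} (hβ : β < 1) (h : IsRadialProfile n β f g w)
    (hc : Tendsto w (𝓝[<] 1) (𝓝 c)) :
    Tendsto (fun r => g r / (1 - r) ^ (1 - β)) (𝓝[<] 1) (𝓝 (c / (1 - β))) := by
  have hp : 0 < 1 - β := sub_pos.2 hβ
  have hG : ∀ r ∈ Ioo (0 : ℝ) 1, HasDerivAt (fun r : ℝ => (1 - r) ^ (1 - β))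
      (-(1 - β) * (1 - r) ^ (-β)) r := by
    intro r hr
    convert! ((hasDerivAt_id r).const_sub 1).rpow_const (p := 1 - β)
      (.inl (sub_pos.2 hr.2).ne') using 1
    rw [show 1 - β - 1 = -β by ring]
    simp
  have hIoo : Ioo (0 : ℝ) 1 ∈ 𝓝[<] (1 : ℝ) := Ioo_mem_nhdsLT one_pos
  refine HasDerivAt.lhopital_zero_left_on_Ioo one_pos (fun r hr => h.hasDerivAt hr) hG ?_ ?_ ?_ ?_
  · intro r hr
    have := Real.rpow_pos_of_pos (sub_pos.2 hr.2) (-β)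
    exact mul_ne_zero (neg_ne_zero.2 hp.ne') this.ne'
  · have h1 := (h.continuousOn 1 ⟨zero_le_one, le_rfl⟩).tendsto
    rw [h.eq_zero] at h1
    rw [← nhdsWithin_Ioo_eq_nhdsLT one_pos]
    exact h1.mono_left (nhdsWithin_mono _ Ioo_subset_Icc_self)
  · have h1 : Continuous fun r : ℝ => (1 - r) ^ (1 - β) :=
      (by fun_prop : Continuous fun r : ℝ => 1 - r).rpow_const fun _ => .inr hp.le
    have h2 := h1.tendsto 1
    rw [sub_self, Real.zero_rpow hp.ne'] at h2
    exact h2.mono_left nhdsWithin_le_nhds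
  -- In l'Hôpital's rule the factors `(1-r)^{-β}` cancel and the quotient of derivatives is `r w /
  -- (1-β)`.
  · have h1 : Tendsto (fun r => r * w r / (1 - β)) (𝓝[<] 1) (𝓝 (1 * c / (1 - β))) :=
      ((tendsto_id.mono_left nhdsWithin_le_nhds).mul hc).div_const _
    rw [one_mul] at h1
    refine h1.congr' ?_
    filter_upwards [hIoo] with r hr
    have := Real.rpow_pos_of_pos (sub_pos.2 hr.2) (-β)
    field_simp

end IsRadialProfile

end UnitBall

/-! ### The two explicit radial profiles -/

section Profiles

variable {N : ℕ} {β : ℝ}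

theorem isRadialProfile_radialSolution₂ (hN : 2 ≤ N) (hβ : β < 1) :
    IsRadialProfile N β (fun _ => 1)
      (fun r => (1 + (1 - β) * r) / (N * (1 - β) * (2 - β)) * (1 - r) ^ (1 - β))
      (fun _ => 1 / (N : ℝ)) := by
  have hN0 : (0 : ℝ) < N := by exact_mod_cast (by omega : 0 < N)
  have hp : 0 < 1 - β := sub_pos.2 hβ
  have hp2 : 0 < 2 - β := by linarith
  refine ⟨?_, ?_, ?_, continuousOn_const, continuousOn_const, ?_, ?_, ?_, ?_⟩
  · refine ContinuousOn.mul (by fun_prop) ?_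
    exact ((by fun_prop : Continuous fun r : ℝ => 1 - r).rpow_const
      fun _ => .inr hp.le).continuousOn
  · simp [Real.zero_rpow hp.ne']
  · intro r hr
    have hr1 : 0 < 1 - r := sub_pos.2 hr.2
    have h1 : HasDerivAt (fun r : ℝ => (1 - r) ^ (1 - β))
        (-1 * (1 - β) * (1 - r) ^ (1 - β - 1)) r :=
      ((hasDerivAt_id r).const_sub 1).rpow_const (.inl hr1.ne')
    have h2 : HasDerivAt (fun r : ℝ => (1 + (1 - β) * r) / (N * (1 - β) * (2 - β)))
        ((1 - β) * 1 / (N * (1 - β) * (2 - β))) r :=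
      (((hasDerivAt_id r).const_mul (1 - β)).const_add 1).div_const _
    convert! (h2.mul h1).hasDerivWithinAt using 1
    have h3 : (1 - r) ^ (1 - β) = (1 - r) ^ (-β) * (1 - r) := by
      rw [← Real.rpow_add_one hr1.ne']; congr 1; ring
    rw [show 1 - β - 1 = -β by ring, h3]
    field_simp
    ring
  · intro r _
    convert! hasDerivAt_const r (1 / (N : ℝ)) using 1
    field_simp
    simp
  · field_simp
  · intro r _
    positivity
  · intro r _
    rw [div_le_one hN0]
    exact_mod_cast (by omega : 1 ≤ N)

/-- The normalized flux `r^{-N} ∫_0^r t^{N-1} (1-t)^β dt`. -/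
noncomputable def normalizedFlux (N : ℕ) (β r : ℝ) : ℝ :=
  ∫ τ in (0 : ℝ)..1, τ ^ ((N : ℝ) - 1) * (1 - r * τ) ^ β

theorem continuous_flux_integrand (hN : 2 ≤ N) (hβ : 0 ≤ β) :
    Continuous fun t : ℝ => t ^ ((N : ℝ) - 1) * (1 - t) ^ β := by
  have hN1 : (0 : ℝ) ≤ N - 1 := by
    have : (2 : ℝ) ≤ N := by exact_mod_cast hN
    linarith
  exact (continuous_id.rpow_const fun _ => .inr hN1).mul
    ((by fun_prop : Continuous fun t : ℝ => 1 - t).rpow_const fun _ => .inr hβ)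

theorem continuous_normalizedFlux (hN : 2 ≤ N) (hβ : 0 ≤ β) : Continuous (normalizedFlux N β) := by
  have hN1 : (0 : ℝ) ≤ N - 1 := by
    have : (2 : ℝ) ≤ N := by exact_mod_cast hN
    linarith
  refine intervalIntegral.continuous_parametric_intervalIntegral_of_continuous' ?_ 0 1
  exact (continuous_snd.rpow_const fun _ => .inr hN1).mul
    ((by fun_prop : Continuous fun x : ℝ × ℝ => 1 - x.1 * x.2).rpow_const fun _ => .inr hβ)

/-- Substituting `t = r τ` turns the singular quotient into an integral over a fixed interval,
continuous in `r` also at `r = 0`. -/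
theorem integral_flux_eq {r : ℝ} (hr : 0 < r) :
    ∫ t in (0 : ℝ)..r, t ^ ((N : ℝ) - 1) * (1 - t) ^ β = r ^ (N : ℝ) * normalizedFlux N β r := by
  have h := intervalIntegral.smul_integral_comp_mul_left (a := 0) (b := 1)
    (fun t : ℝ => t ^ ((N : ℝ) - 1) * (1 - t) ^ β) r
  rw [mul_zero, mul_one] at h
  rw [← h, normalizedFlux, smul_eq_mul, ← intervalIntegral.integral_const_mul,
    ← intervalIntegral.integral_const_mul]
  refine intervalIntegral.integral_congr fun τ hτ => ?_
  rw [uIcc_of_le zero_le_one] at hτ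
  have : r ^ (N : ℝ) = r * r ^ ((N : ℝ) - 1) := by
    rw [Real.rpow_sub_one hr.ne']; field_simp
  simp only [Real.mul_rpow hr.le hτ.1, this]
  ring

theorem normalizedFlux_pos (hN : 2 ≤ N) (hβ : 0 ≤ β) {r : ℝ} (hr : r ≤ 1) :
    0 < normalizedFlux N β r := by
  have hN1 : (0 : ℝ) ≤ N - 1 := by
    have : (2 : ℝ) ≤ N := by exact_mod_cast hN
    linarith
  refine intervalIntegral.intervalIntegral_pos_of_pos_on ?_ ?_ one_pos
  · refine Continuous.intervalIntegrable ?_ _ _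
    exact (continuous_id.rpow_const fun _ => .inr hN1).mul
      ((by fun_prop : Continuous fun x : ℝ => 1 - r * x).rpow_const fun _ => .inr hβ)
  · intro τ hτ
    have : 0 < 1 - r * τ := by nlinarith [hτ.1, hτ.2]
    have := hτ.1
    positivity

theorem normalizedFlux_le_one (hN : 2 ≤ N) (hβ : 0 ≤ β) {r : ℝ} (h0 : 0 ≤ r) (hr : r ≤ 1) :
    normalizedFlux N β r ≤ 1 := by
  have hN1 : (0 : ℝ) ≤ N - 1 := by
    have : (2 : ℝ) ≤ N := by exact_mod_cast hN
    linarith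
  have := intervalIntegral.norm_integral_le_of_norm_le_const (a := (0 : ℝ)) (b := 1) (C := 1)
    (f := fun τ : ℝ => τ ^ ((N : ℝ) - 1) * (1 - r * τ) ^ β) ?_
  · unfold normalizedFlux
    simpa using (le_abs_self _).trans this
  · intro τ hτ
    rw [uIoc_of_le zero_le_one] at hτ
    have h1 : 0 ≤ 1 - r * τ := by nlinarith [hτ.1, hτ.2]
    have h2 : τ ^ ((N : ℝ) - 1) ≤ 1 := Real.rpow_le_one hτ.1.le hτ.2 hN1
    have h3 : (1 - r * τ) ^ β ≤ 1 := Real.rpow_le_one h1 (by nlinarith [hτ.1]) hβ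
    have h4 := Real.rpow_nonneg hτ.1.le ((N : ℝ) - 1)
    have h5 := Real.rpow_nonneg h1 β
    rw [Real.norm_of_nonneg (by positivity)]
    nlinarith

theorem normalizedFlux_zero (hN : 2 ≤ N) : N * normalizedFlux N β 0 = 1 := by
  have hN0 : (0 : ℝ) < N := by exact_mod_cast (by omega : 0 < N)
  have : normalizedFlux N β 0 = 1 / N := by
    simp only [normalizedFlux, zero_mul, sub_zero, Real.one_rpow, mul_one]
    rw [integral_rpow (.inl (by linarith))]
    simp [Real.zero_rpow hN0.ne']
  rw [this]
  field_simp

/-- Away from `0` the flux is `r^{-N}` times a primitive, so the product rule replaces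
differentiation under the integral sign. -/
theorem hasDerivAt_normalizedFlux (hN : 2 ≤ N) (hβ : 0 ≤ β) {r : ℝ} (hr : 0 < r) :
    HasDerivAt (normalizedFlux N β) (((1 - r) ^ β - N * normalizedFlux N β r) / r) r := by
  have hF : HasDerivAt (fun r => ∫ t in (0 : ℝ)..r, t ^ ((N : ℝ) - 1) * (1 - t) ^ β)
      (r ^ ((N : ℝ) - 1) * (1 - r) ^ β) r :=
    (continuous_flux_integrand hN hβ).integral_hasStrictDerivAt 0 r |>.hasDerivAt
  have h1 : HasDerivAt (fun r : ℝ => r ^ (-(N : ℝ))) (-N * r ^ (-(N : ℝ) - 1)) r :=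
    Real.hasDerivAt_rpow_const (.inl hr.ne')
  have h2 := (h1.mul hF).congr_of_eventuallyEq (f₁ := normalizedFlux N β) ?_
  · convert! h2 using 1
    rw [integral_flux_eq hr, Real.rpow_sub_one hr.ne', Real.rpow_sub_one hr.ne',
      Real.rpow_neg hr.le]
    have := Real.rpow_pos_of_pos hr (N : ℝ)
    field_simp
    ring
  · filter_upwards [lt_mem_nhds hr] with s hs
    simp only [Pi.mul_apply]
    rw [integral_flux_eq hs, ← mul_assoc, ← Real.rpow_add hs]
    simp

theorem intervalIntegrable_flux_profile (hN : 2 ≤ N) (hβ : 0 ≤ β) (hβ1 : β < 1) :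
    IntervalIntegrable (fun s => s * ((1 - s) ^ (-β) * normalizedFlux N β s)) volume 0 1 := by
  have h1 : IntervalIntegrable (fun s : ℝ => (1 - s) ^ (-β)) volume 0 1 := by
    have := (intervalIntegral.intervalIntegrable_rpow' (a := 0) (b := 1)
      (r := -β) (by linarith)).comp_sub_left 1
    simpa using this.symm
  have h2 := h1.mul_continuousOn (g := fun s => s * normalizedFlux N β s)
    (continuous_id.mul (continuous_normalizedFlux hN hβ)).continuousOn
  refine h2.congr fun s _ => ?_
  ring

theorem isRadialProfile_radialSolution₁ (hN : 2 ≤ N) (hβ : 0 ≤ β) (hβ1 : β < 1) :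
    IsRadialProfile N β (fun r => (1 - r) ^ β)
      (fun r => ∫ s in r..1, s * ((1 - s) ^ (-β) * normalizedFlux N β s))
      (normalizedFlux N β) := by
  have hint := intervalIntegrable_flux_profile hN hβ hβ1
  have hcont := continuous_normalizedFlux hN hβ
  refine ⟨?_, by simp, ?_, hcont.continuousOn, ?_, ?_, ?_, ?_, ?_⟩
  · have h1 : IntegrableOn (fun s => s * ((1 - s) ^ (-β) * normalizedFlux N β s)) (uIcc 0 1) := by
      rw [uIcc_of_le zero_le_one, integrableOn_Icc_iff_integrableOn_Ioc]
      exact (intervalIntegrable_iff_integrableOn_Ioc_of_le zero_le_one).1 hint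
    have := intervalIntegral.continuousOn_primitive_interval_left h1
    rwa [uIcc_of_le zero_le_one] at this
  · intro r hr
    -- The integrand is continuous on both sides of every `r < 1`, including `r = 0`, so the
    -- fundamental theorem of calculus applies there too.
    have hc : ContinuousOn (fun s => s * ((1 - s) ^ (-β) * normalizedFlux N β s)) (Iio 1) := by
      refine continuousOn_id.mul (ContinuousOn.mul ?_ hcont.continuousOn)
      exact (by fun_prop : Continuous fun r : ℝ => 1 - r).continuousOn.rpow_const fun s hs =>
        .inl (sub_pos.2 hs).ne'
    have hi : IntervalIntegrable (fun s => s * ((1 - s) ^ (-β) * normalizedFlux N β s))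
        volume r 1 := by
      refine hint.mono_set ?_
      rw [uIcc_of_le zero_le_one, uIcc_of_le hr.2.le]
      exact Icc_subset_Icc_left hr.1
    have := intervalIntegral.integral_hasDerivAt_left hi
      (hc.stronglyMeasurableAtFilter isOpen_Iio r hr.2) (hc.continuousAt (Iio_mem_nhds hr.2))
    rw [mul_neg]
    exact this.hasDerivWithinAt
  · exact ((by fun_prop : Continuous fun r : ℝ => 1 - r).rpow_const
      fun _ => .inr hβ).continuousOn
  · exact fun r hr => hasDerivAt_normalizedFlux hN hβ hr.1
  · simp [normalizedFlux_zero hN]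
  · exact fun r hr => normalizedFlux_pos hN hβ hr.2.le
  · exact fun r hr => normalizedFlux_le_one hN hβ hr.1.le hr.2.le

theorem radialSolution₁_eq {x : EuclideanSpace ℝ (Fin N)} (hx : ‖x‖ ≤ 1) :
    radialSolution₁ N β x = ∫ s in ‖x‖..1, s * ((1 - s) ^ (-β) * normalizedFlux N β s) := by
  refine intervalIntegral.integral_congr fun s hs => ?_
  rw [uIcc_of_le hx] at hs
  rcases eq_or_lt_of_le ((norm_nonneg x).trans hs.1) with h0 | h0
  · simp [← h0]
  · rw [integral_flux_eq h0]
    have : s ^ (1 - (N : ℝ)) * s ^ (N : ℝ) = s := by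
      rw [← Real.rpow_add h0]; simp
    linear_combination ((1 - s) ^ (-β) * normalizedFlux N β s) * this

end Profiles

/-! ### Volume of the boundary layer -/

section BoundaryLayer

/-- If the translates of `A` by `k s e`, `k < R / s`, are pairwise disjoint, then the measure of `A`
is at most a constant multiple of `s`. -/
theorem measureReal_le_of_disjoint_translates {E : Type*} [NormedAddCommGroup E] [NormedSpace ℝ E]
    [FiniteDimensional ℝ E] [MeasurableSpace E] [BorelSpace E] (μ : Measure E)
    [μ.IsAddHaarMeasure] {A : Set E} (hA : MeasurableSet A) {x₀ e : E} {R s : ℝ} (hR : 0 < R)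
    (hs : 0 < s) (hAb : A ⊆ Metric.ball x₀ R)
    (hdisj : ∀ x ∈ A, ∀ t : ℝ, s ≤ |t| → x + t • e ∉ A) :
    μ.real A ≤ μ.real (Metric.ball x₀ (R + R * ‖e‖)) / R * s := by
  -- With this choice `k < K` means `k s < R`, so the `K ≥ R / s` disjoint translates all fit in the
  -- larger ball.
  set K := ⌈R / s⌉₊
  let T : ℕ → Set E := fun k => (fun x => x + (k * s) • e) ⁻¹' A
  have hTm : ∀ k, MeasurableSet (T k) := fun k => (measurable_add_const _) hA
  have hT : ∀ k, μ.real (T k) = μ.real A := fun k => by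
    simp only [T, measureReal_def, measure_preimage_add_right]
  have hpd : PairwiseDisjoint (Finset.range K : Set ℕ) T := by
    intro k _ l _ hkl
    refine Set.disjoint_left.2 fun x hx hy => ?_
    refine hdisj _ hx ((l - k : ℝ) * s) ?_ ?_
    · rw [abs_mul, abs_of_pos hs]
      refine le_mul_of_one_le_left hs.le ?_
      have : (l : ℤ) - k ≠ 0 := sub_ne_zero.2 (by exact_mod_cast hkl.symm)
      exact_mod_cast Int.one_le_abs this
    · have : x + ((k : ℝ) * s) • e + ((l - k : ℝ) * s) • e = x + ((l : ℝ) * s) • e := by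
        module
      rwa [this]
  have hsub : (⋃ k ∈ Finset.range K, T k) ⊆ Metric.ball x₀ (R + R * ‖e‖) := by
    intro x hx
    simp only [mem_iUnion, Finset.mem_range] at hx
    obtain ⟨k, hk, hx⟩ := hx
    have h1 : x + ((k : ℝ) * s) • e ∈ Metric.ball x₀ R := hAb hx
    have h2 : (k : ℝ) * s < R := by
      rw [← lt_div_iff₀ hs]
      exact Nat.lt_ceil.1 hk
    rw [mem_ball_iff_norm] at h1 ⊢
    have h3 : x - x₀ = (x + ((k : ℝ) * s) • e - x₀) - ((k : ℝ) * s) • e := by abel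
    rw [h3]
    refine (norm_sub_le _ _).trans_lt ?_
    have h4 : ‖((k : ℝ) * s) • e‖ ≤ R * ‖e‖ := by
      rw [norm_smul, Real.norm_of_nonneg (by positivity)]
      gcongr
    linarith
  have h1 : (K : ℝ) * μ.real A ≤ μ.real (Metric.ball x₀ (R + R * ‖e‖)) := by
    calc (K : ℝ) * μ.real A = ∑ k ∈ Finset.range K, μ.real (T k) := by simp [hT]
      _ = μ.real (⋃ k ∈ Finset.range K, T k) :=
          (measureReal_biUnion_finset hpd (fun k _ => hTm k) (fun k _ => by
            rw [measure_preimage_add_right]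
            exact ((measure_mono hAb).trans_lt measure_ball_lt_top).ne)).symm
      _ ≤ _ := measureReal_mono hsub measure_ball_lt_top.ne
  have h2 : R / s * μ.real A ≤ μ.real (Metric.ball x₀ (R + R * ‖e‖)) :=
    (mul_le_mul_of_nonneg_right (Nat.le_ceil _) measureReal_nonneg).trans h1
  rw [div_mul_eq_mul_div, div_le_iff₀ hs] at h2
  rw [div_mul_eq_mul_div, le_div_iff₀ hR]
  linarith

variable {N : ℕ} {Ω : Set (EuclideanSpace ℝ (Fin N))}

theorem eq_zero_of_mem_frontier_of_inter_eq {X : Type*} [TopologicalSpace X] {Ω U : Set X}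
    (hΩ : IsOpen Ω) (hU : IsOpen U) {ρ : X → ℝ} (hρ : ContinuousOn ρ U)
    (h : Ω ∩ U = {x ∈ U | 0 < ρ x}) {z : X} (hz : z ∈ frontier Ω) (hzU : z ∈ U) : ρ z = 0 := by
  have hzΩ : z ∉ Ω := fun h => by
    have : z ∈ Ω ∩ frontier Ω := ⟨h, hz⟩
    simp [hΩ.inter_frontier_eq] at this
  refine le_antisymm (not_lt.1 fun hpos => hzΩ ?_) (not_lt.1 fun hneg => ?_)
  · have : z ∈ Ω ∩ U := h ▸ ⟨hzU, hpos⟩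
    exact this.1
  · have h1 : ∀ᶠ y in 𝓝 z, y ∈ U ∧ ρ y < 0 :=
      Filter.Eventually.and (hU.mem_nhds hzU) ((hρ.continuousAt (hU.mem_nhds hzU)).eventually_lt_const hneg)
    obtain ⟨y, hy, hyΩ⟩ := mem_closure_iff_nhds.1 hz.1 _ h1
    have : y ∈ {x ∈ U | 0 < ρ x} := h ▸ ⟨hyΩ, hy.1⟩
    exact lt_asymm hy.2 this.2

/-- In the layer the defining function is `O(ε)`, while along a transversal direction `e` it changes
at rate close to `1`. Translates of the layer by multiples of `ε e`, with a large enough factor, are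
therefore disjoint. -/
theorem DegeneratePoisson.IsBoundedC2Domain.exists_measureReal_thickening_inter_ball_le (hΩ : IsBoundedC2Domain Ω)
    {x₀ : EuclideanSpace ℝ (Fin N)} (hx₀ : x₀ ∈ frontier Ω) :
    ∃ r > 0, ∃ C, ∀ ε, 0 < ε → ε ≤ r →
      volume.real (Metric.thickening ε (frontier Ω) ∩ Metric.ball x₀ r) ≤ C * ε := by
  obtain ⟨U, ρ, hU, hxU, hρ, hρ', hUΩ⟩ := hΩ.boundary x₀ hx₀
  set L := fderiv ℝ ρ x₀
  obtain ⟨e, he⟩ : ∃ e, L e = 1 := by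
    obtain ⟨v, hv⟩ := DFunLike.ne_iff.1 (hρ' x₀ hxU)
    exact ⟨(L v)⁻¹ • v, by simpa using inv_mul_cancel₀ hv⟩
  have hstrict : HasStrictFDerivAt ρ L x₀ :=
    (hρ.contDiffAt (hU.mem_nhds hxU)).hasStrictFDerivAt (by norm_num)
  -- Chosen so that the linearization error along `t e` is at most `|t| / 2`.
  set c : ℝ := 1 / (2 * (‖e‖ + 1)) with hc
  have hcpos : 0 < c := by positivity
  have hce : c * ‖e‖ ≤ 1 / 2 := by
    rw [hc, div_mul_eq_mul_div, one_mul, div_le_iff₀ (by positivity)]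
    linarith
  have hev := hstrict.isLittleO.def hcpos
  rw [nhds_prod_eq] at hev
  obtain ⟨V, hV, hVρ⟩ := eventually_prod_self_iff'.1 hev
  obtain ⟨R, hR, hRV⟩ := Metric.mem_nhds_iff.1 (inter_mem hV (hU.mem_nhds hxU))
  have hest : ∀ x ∈ Metric.ball x₀ R, ∀ y ∈ Metric.ball x₀ R,
      |ρ x - ρ y - L (x - y)| ≤ c * ‖x - y‖ := fun x hx y hy =>
    hVρ x (hRV hx).1 y (hRV hy).1
  set Λ := ‖L‖ + c with hΛ
  have hΛ0 : 0 ≤ Λ := by positivity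
  -- Halving the radius keeps the nearby boundary point `z`, where `ρ = 0`, inside the ball on which
  -- the linearization holds.
  have hsmall : ∀ ε, ε ≤ R / 2 → ∀ x ∈ Metric.thickening ε (frontier Ω) ∩ Metric.ball x₀ (R / 2),
      x ∈ Metric.ball x₀ R ∧ |ρ x| ≤ Λ * ε := by
    rintro ε hε x ⟨hx, hxb⟩
    obtain ⟨z, hz, hxz⟩ := Metric.mem_thickening_iff.1 hx
    rw [Metric.mem_ball] at hxb
    have hxR : x ∈ Metric.ball x₀ R := Metric.mem_ball.2 (by linarith)
    have hzR : z ∈ Metric.ball x₀ R := by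
      rw [Metric.mem_ball]
      have := dist_triangle z x x₀
      rw [dist_comm z x] at this
      linarith
    have hz0 := eq_zero_of_mem_frontier_of_inter_eq hΩ.isOpen hU hρ.continuousOn hUΩ hz
      (hRV hzR).2
    refine ⟨hxR, ?_⟩
    have h1 := hest x hxR z hzR
    rw [hz0, sub_zero] at h1
    have h2 := L.le_opNorm (x - z)
    rw [Real.norm_eq_abs] at h2
    rw [dist_eq_norm] at hxz
    have h3 : |ρ x| ≤ |ρ x - L (x - z)| + |L (x - z)| := by
      have := abs_add_le (ρ x - L (x - z)) (L (x - z))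
      simpa using this
    calc |ρ x| ≤ Λ * ‖x - z‖ := by rw [hΛ, add_mul]; linarith
      _ ≤ Λ * ε := by gcongr
  refine ⟨R / 2, by positivity,
    volume.real (Metric.ball x₀ (R / 2 + R / 2 * ‖e‖)) / (R / 2) * (5 * (Λ + 1)),
    fun ε hε hεR => ?_⟩
  rw [mul_assoc]
  refine measureReal_le_of_disjoint_translates volume (e := e)
    (Metric.isOpen_thickening.inter Metric.isOpen_ball).measurableSet (by positivity)
    (by positivity) inter_subset_right ?_
  intro x hx t ht hxt
  obtain ⟨hxR, hρx⟩ := hsmall ε hεR x hx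
  obtain ⟨hyR, hρy⟩ := hsmall ε hεR _ hxt
  have h1 := hest _ hyR x hxR
  rw [add_sub_cancel_left, map_smul, he, smul_eq_mul, mul_one, norm_smul, Real.norm_eq_abs] at h1
  have h2 : c * (|t| * ‖e‖) ≤ |t| / 2 := by
    have := mul_le_mul_of_nonneg_left hce (abs_nonneg t)
    linarith
  have h3 : |t| ≤ |ρ (x + t • e) - ρ x - t| + (|ρ (x + t • e)| + |ρ x|) := by
    have h4 := abs_sub (ρ (x + t • e)) (ρ x)
    have h5 := abs_sub (ρ (x + t • e) - ρ x) (ρ (x + t • e) - ρ x - t)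
    rw [sub_sub_cancel] at h5
    linarith
  -- Both values of `ρ` are at most `Λ ε` in size, so `|t| / 2 ≤ 2 Λ ε`, contradicting `|t| ≥ 5 (Λ +
  -- 1) ε`.
  nlinarith

/-- The volume of the boundary layer of width `ε` is at most a multiple of `ε`. -/
theorem DegeneratePoisson.IsBoundedC2Domain.exists_measureReal_thickening_le (hΩ : IsBoundedC2Domain Ω) :
    ∃ ε₀ > 0, ∃ C, 0 ≤ C ∧ ∀ ε, 0 < ε → ε ≤ ε₀ →
      volume.real (Metric.thickening ε (frontier Ω)) ≤ C * ε := by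
  have hK : IsCompact (frontier Ω) :=
    Metric.isCompact_of_isClosed_isBounded isClosed_frontier
      (hΩ.isBounded.closure.subset frontier_subset_closure)
  choose! r hr C hC using fun x (hx : x ∈ frontier Ω) =>
    hΩ.exists_measureReal_thickening_inter_ball_le hx
  obtain ⟨t, ht, htK⟩ := hK.elim_nhds_subcover (fun x => Metric.ball x (r x))
    fun x hx => Metric.ball_mem_nhds x (hr x hx)
  obtain ⟨δ, hδ, hδK⟩ := hK.exists_thickening_subset_open
    (isOpen_biUnion fun x _ => Metric.isOpen_ball) htK
  obtain ⟨ε₁, hε₁, hε₁r⟩ : ∃ ε₁ > 0, ∀ x ∈ t, ε₁ ≤ r x := by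
    rcases t.eq_empty_or_nonempty with rfl | hne
    · exact ⟨1, one_pos, by simp⟩
    · obtain ⟨y, hy, hmin⟩ := t.exists_min_image r hne
      exact ⟨r y, hr y (ht y hy), hmin⟩
  refine ⟨min δ ε₁, lt_min hδ hε₁, ∑ x ∈ t, |C x|, Finset.sum_nonneg fun _ _ => abs_nonneg _,
    fun ε hε hεm => ?_⟩
  have hsub : Metric.thickening ε (frontier Ω) ⊆
      ⋃ x ∈ t, Metric.thickening ε (frontier Ω) ∩ Metric.ball x (r x) := by
    intro y hy
    have := hδK (Metric.thickening_mono (hεm.trans (min_le_left _ _)) _ hy)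
    simp only [mem_iUnion] at this ⊢
    obtain ⟨x, hx, hyx⟩ := this
    exact ⟨x, hx, hy, hyx⟩
  have hfin : volume (⋃ x ∈ t, Metric.thickening ε (frontier Ω) ∩ Metric.ball x (r x)) ≠ ⊤ :=
    ((measure_biUnion_finset_le _ _).trans_lt (ENNReal.sum_lt_top.2 fun x _ =>
      (measure_mono inter_subset_right).trans_lt measure_ball_lt_top)).ne
  calc _ ≤ _ := measureReal_mono hsub hfin
    _ ≤ ∑ x ∈ t, volume.real (Metric.thickening ε (frontier Ω) ∩ Metric.ball x (r x)) :=
        measureReal_biUnion_finset_le _ _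
    _ ≤ ∑ x ∈ t, |C x| * ε := by
        refine Finset.sum_le_sum fun x hx => ?_
        refine (hC x (ht x hx) ε hε (hεm.trans ((min_le_right _ _).trans (hε₁r x hx)))).trans ?_
        gcongr
        exact le_abs_self _
    _ = _ := by rw [Finset.sum_mul]

end BoundaryLayer

/-! ### Smooth approximation by convolution -/

section Mollification

open scoped Convolution

variable {E : Type*} [NormedAddCommGroup E] [InnerProductSpace ℝ E] [FiniteDimensional ℝ E]
  [MeasurableSpace E] [BorelSpace E]

/-- The centred bump function with radii `δ / 2` and `δ`. -/
noncomputable def mollifierBump (E : Type*) [NormedAddCommGroup E] {δ : ℝ} (hδ : 0 < δ) :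
    ContDiffBump (0 : E) :=
  ⟨δ / 2, δ, by positivity, by linarith⟩

/-- Derivatives pass onto `φ` under convolution, and `φ` and its derivative are uniformly
continuous, so one small radius serves both estimates. -/
theorem exists_contDiff_approx {φ : E → ℝ} (hφ : ContDiff ℝ 1 φ) (hc : HasCompactSupport φ)
    {δ ε : ℝ} (hδ : 0 < δ) (hε : 0 < ε) :
    ∃ ψ : E → ℝ, ContDiff ℝ ∞ ψ ∧ tsupport ψ ⊆ Metric.cthickening δ (tsupport φ) ∧
      (∀ x, |ψ x - φ x| ≤ ε) ∧ ∀ x, ‖fderiv ℝ ψ x - fderiv ℝ φ x‖ ≤ ε := by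
  have hdφ : Continuous (fderiv ℝ φ) := hφ.continuous_fderiv one_ne_zero
  obtain ⟨δ₁, hδ₁, h₁⟩ := Metric.uniformContinuous_iff.1
    (hc.uniformContinuous_of_continuous hφ.continuous) ε hε
  obtain ⟨δ₂, hδ₂, h₂⟩ := Metric.uniformContinuous_iff.1
    ((hc.fderiv ℝ).uniformContinuous_of_continuous hdφ) ε hε
  have hm : 0 < min δ (min δ₁ δ₂) := by positivity
  set b := mollifierBump E hm
  have hb : b.rOut = min δ (min δ₁ δ₂) := rfl
  refine ⟨b.normed volume ⋆[ContinuousLinearMap.lsmul ℝ ℝ, volume] φ, ?_, ?_, ?_, ?_⟩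
  · exact b.hasCompactSupport_normed.contDiff_convolution_left _ b.contDiff_normed
      hφ.continuous.locallyIntegrable
  · refine closure_minimal ?_ Metric.isClosed_cthickening
    refine (support_convolution_subset _).trans ?_
    rintro x ⟨y, hy, z, hz, rfl⟩
    rw [b.support_normed_eq, mem_ball_zero_iff, hb] at hy
    refine Metric.mem_cthickening_of_dist_le (y + z) z δ _ (subset_tsupport φ hz) ?_
    rw [dist_eq_norm, add_sub_cancel_right]
    exact hy.le.trans (min_le_left _ _)
  · intro x
    refine b.dist_normed_convolution_le hφ.continuous.aestronglyMeasurable fun y hy => ?_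
    exact (h₁ ((Metric.mem_ball.1 hy).trans_le
      (hb.le.trans ((min_le_right _ _).trans (min_le_left _ _))))).le
  · intro x
    have h := (hc.hasFDerivAt_convolution_right (ContinuousLinearMap.lsmul ℝ ℝ)
      (b.integrable_normed (μ := volume)).locallyIntegrable hφ x).fderiv
    have e : ((b.normed volume) ⋆[(ContinuousLinearMap.lsmul ℝ ℝ).precompR E, volume]
        fderiv ℝ φ) x =
        ((b.normed volume) ⋆[ContinuousLinearMap.lsmul ℝ ℝ, volume] fderiv ℝ φ) x := by
      simp only [convolution_def]
      congr 1
    rw [h, e, ← dist_eq_norm]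
    refine b.dist_normed_convolution_le hdφ.aestronglyMeasurable fun y hy => ?_
    exact (h₂ ((Metric.mem_ball.1 hy).trans_le
      (hb.le.trans ((min_le_right _ _).trans (min_le_right _ _))))).le

/-- A Lipschitz function can be approximated uniformly by smooth functions with the same Lipschitz
constant. -/
theorem LipschitzWith.exists_contDiff_approx {g : E → ℝ} (hg : LipschitzWith 1 g) {ε : ℝ}
    (hε : 0 < ε) : ∃ D : E → ℝ, ContDiff ℝ ∞ D ∧ (∀ x, |D x - g x| ≤ ε) ∧ LipschitzWith 1 D := by
  set b := mollifierBump E hε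
  have hb : b.rOut = ε := rfl
  refine ⟨b.normed volume ⋆[ContinuousLinearMap.lsmul ℝ ℝ, volume] g, ?_, ?_, ?_⟩
  · exact b.hasCompactSupport_normed.contDiff_convolution_left _ b.contDiff_normed
      hg.continuous.locallyIntegrable
  · intro x
    refine b.dist_normed_convolution_le hg.continuous.aestronglyMeasurable fun y hy => ?_
    have := hg.dist_le_mul y x
    simp only [NNReal.coe_one, one_mul] at this
    exact this.trans ((Metric.mem_ball.1 hy).le.trans hb.le)
  · have hint : ∀ x, Integrable (fun t => b.normed volume t * g (x - t)) (volume : Measure E) :=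
      fun x => (b.continuous_normed.mul (hg.continuous.comp
        (continuous_const.sub continuous_id))).integrable_of_hasCompactSupport
          b.hasCompactSupport_normed.mul_right
    refine LipschitzWith.of_dist_le_mul fun x y => ?_
    simp only [convolution_def, ContinuousLinearMap.lsmul_apply, smul_eq_mul]
    rw [dist_eq_norm, ← integral_sub (hint x) (hint y)]
    calc _ ≤ ∫ t, b.normed volume t * dist x y := by
          refine norm_integral_le_of_norm_le (b.integrable_normed.mul_const _)
            (Eventually.of_forall fun t => ?_)
          rw [← mul_sub, norm_mul, Real.norm_of_nonneg (b.nonneg_normed t)]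
          refine mul_le_mul_of_nonneg_left ?_ (b.nonneg_normed t)
          have := hg.dist_le_mul (x - t) (y - t)
          rwa [dist_sub_right, NNReal.coe_one, one_mul] at this
      _ = _ := by rw [integral_mul_const, b.integral_normed]; simp

end Mollification

/-! ### Cutoff functions adapted to the boundary layer -/

section Cutoffs

theorem exists_bound_deriv_of_eventually_const {X : ℝ → ℝ} (hX : ContDiff ℝ ∞ X) {a b : ℝ}
    (ha : ∀ t < a, deriv X t = 0) (hb : ∀ t, b < t → deriv X t = 0) :
    ∃ M, ∀ t, |deriv X t| ≤ M := by
  obtain ⟨M, hM⟩ := isCompact_Icc.exists_bound_of_continuousOn (s := Icc a b)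
    (hX.continuous_deriv (by simp)).continuousOn
  refine ⟨max M 0, fun t => ?_⟩
  by_cases h : t ∈ Icc a b
  · exact (hM t h).trans (le_max_left _ _)
  · rw [mem_Icc, not_and_or, not_le, not_le] at h
    rcases h with h | h
    · simp [ha t h]
    · simp [hb t h]

theorem deriv_eq_zero_of_eqOn_const {X : ℝ → ℝ} {U : Set ℝ} (hU : IsOpen U) {c : ℝ}
    (h : ∀ t ∈ U, X t = c) {t : ℝ} (ht : t ∈ U) : deriv X t = 0 := by
  have : X =ᶠ[𝓝 t] fun _ => c := by
    filter_upwards [hU.mem_nhds ht] with s hs using h s hs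
  rw [this.deriv_eq, deriv_const]

/-- Two smooth functions of one variable, from which the cutoff functions are built. -/
theorem exists_cutoff_profiles : ∃ (X Z : ℝ → ℝ) (M : ℝ), ContDiff ℝ ∞ X ∧ ContDiff ℝ ∞ Z ∧
    (∀ t, 0 ≤ X t) ∧ (∀ t ≤ 1, X t = 0) ∧ (∀ t, 2 ≤ t → X t = 1) ∧
    (∀ t, 0 ≤ Z t ∧ Z t ≤ 1) ∧ (∀ t ≤ 1 / 2, Z t = 0) ∧ (∀ t, 3 ≤ t → Z t = 0) ∧
    (∀ t, deriv X t ≠ 0 → Z t = 1) ∧ (∀ t, |deriv X t| ≤ M) ∧ ∀ t, |deriv Z t| ≤ M := by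
  let χ := Real.smoothTransition
  have hχ : ContDiff ℝ ∞ χ := Real.smoothTransition.contDiff
  let X : ℝ → ℝ := fun t => χ (t - 1)
  -- A plateau equal to `1` on `[1, 2]`, the interval on which `X` climbs from `0` to `1`.
  let Z : ℝ → ℝ := fun t => χ (2 * t - 1) * χ (3 - t)
  have hX : ContDiff ℝ ∞ X := hχ.comp (contDiff_id.sub contDiff_const)
  have hZ : ContDiff ℝ ∞ Z := (hχ.comp ((contDiff_const.mul contDiff_id).sub contDiff_const)).mul
    (hχ.comp (contDiff_const.sub contDiff_id))
  have hX1 : ∀ t ≤ 1, X t = 0 := fun t ht =>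
    Real.smoothTransition.zero_of_nonpos (by linarith)
  have hX2 : ∀ t, 2 ≤ t → X t = 1 := fun t ht =>
    Real.smoothTransition.one_of_one_le (by linarith)
  have hZ1 : ∀ t ≤ 1 / 2, Z t = 0 := fun t ht =>
    mul_eq_zero_of_left (Real.smoothTransition.zero_of_nonpos (by linarith)) _
  have hZ2 : ∀ t, 3 ≤ t → Z t = 0 := fun t ht =>
    mul_eq_zero_of_right _ (Real.smoothTransition.zero_of_nonpos (by linarith))
  have hX1' : ∀ t < 1, deriv X t = 0 := fun t ht =>
    deriv_eq_zero_of_eqOn_const isOpen_Iio (fun s (hs : s < 1) => hX1 s hs.le) ht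
  have hX2' : ∀ t, 2 < t → deriv X t = 0 := fun t ht =>
    deriv_eq_zero_of_eqOn_const isOpen_Ioi (fun s (hs : 2 < s) => hX2 s hs.le) ht
  obtain ⟨M₁, hM₁⟩ := exists_bound_deriv_of_eventually_const hX hX1' hX2'
  obtain ⟨M₂, hM₂⟩ := exists_bound_deriv_of_eventually_const hZ (a := 1 / 2) (b := 3)
    (fun t ht => deriv_eq_zero_of_eqOn_const isOpen_Iio (fun s (hs : s < 1 / 2) => hZ1 s hs.le) ht)
    (fun t ht => deriv_eq_zero_of_eqOn_const isOpen_Ioi (fun s (hs : 3 < s) => hZ2 s hs.le) ht)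
  refine ⟨X, Z, max M₁ M₂, hX, hZ, fun t => Real.smoothTransition.nonneg _, hX1, hX2,
    fun t => ⟨mul_nonneg (Real.smoothTransition.nonneg _) (Real.smoothTransition.nonneg _),
      mul_le_one₀ (Real.smoothTransition.le_one _) (Real.smoothTransition.nonneg _)
        (Real.smoothTransition.le_one _)⟩, hZ1, hZ2, fun t ht => ?_,
    fun t => (hM₁ t).trans (le_max_left _ _), fun t => (hM₂ t).trans (le_max_right _ _)⟩
  have h1 : 1 ≤ t := by
    by_contra! h
    exact ht (hX1' t h)
  have h2 : t ≤ 2 := by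
    by_contra! h
    exact ht (hX2' t h)
  change χ (2 * t - 1) * χ (3 - t) = 1
  rw [show χ (2 * t - 1) = 1 from Real.smoothTransition.one_of_one_le (by linarith),
    show χ (3 - t) = 1 from Real.smoothTransition.one_of_one_le (by linarith), one_mul]

/-- Cutoff functions for a bounded open set: `η` vanishes near the boundary and equals `1` at
distance `s`, and `ζ` equals `1` on the support of `∇η` and is supported in the boundary layer. -/
theorem exists_cutoffs {E : Type*} [NormedAddCommGroup E] [InnerProductSpace ℝ E]
    [FiniteDimensional ℝ E] [MeasurableSpace E] [BorelSpace E] {Ω : Set E}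
    (hb : Bornology.IsBounded Ω) :
    ∃ M, ∀ s > 0, ∃ η ζ : E → ℝ, ContDiff ℝ ∞ η ∧ ContDiff ℝ ∞ ζ ∧
      HasCompactSupport η ∧ HasCompactSupport ζ ∧ tsupport η ⊆ Ω ∧ tsupport ζ ⊆ Ω ∧
      (∀ x, 0 ≤ η x) ∧ (∀ x, s ≤ Metric.infDist x Ωᶜ → η x = 1) ∧
      (∀ x, 0 ≤ ζ x ∧ ζ x ≤ 1) ∧ (∀ x, fderiv ℝ η x ≠ 0 → ζ x = 1) ∧
      (∀ x ∈ tsupport ζ, Metric.infDist x Ωᶜ < s) ∧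
      (∀ x, ‖fderiv ℝ η x‖ ≤ M / s) ∧ ∀ x, ‖fderiv ℝ ζ x‖ ≤ M / s := by
  obtain ⟨X, Z, M, hX, hZ, hX0, hX1, hX2, hZ0, hZ1, hZ2, hXZ, hXM, hZM⟩ := exists_cutoff_profiles
  refine ⟨4 * M, fun s hs => ?_⟩
  -- With `D` within `ε / 4` of the distance to `Ωᶜ`, the profiles at `D / ε` have room on both
  -- sides: `D ≤ ε / 4` off `Ω`, where both vanish, while `D ≤ 3 ε` forces the distance below `4 ε =
  -- s`, and distance at least `s` forces `D ≥ 2 ε`.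
  set ε := s / 4 with hε
  have hεpos : 0 < ε := by positivity
  obtain ⟨D, hD, hDd, hDL⟩ :=
    (Metric.lipschitz_infDist_pt Ωᶜ).exists_contDiff_approx (ε := ε / 4) (by positivity)
  have hDd' : ∀ x, D x - Metric.infDist x Ωᶜ ≤ ε / 4 ∧ Metric.infDist x Ωᶜ - D x ≤ ε / 4 :=
    fun x => ⟨(le_abs_self _).trans (hDd x), by
      have := (neg_abs_le _).trans' (neg_le_neg (hDd x)); linarith⟩
  have hsup : ∀ {ψ : E → ℝ}, (∀ x, D x / ε ≤ 1 / 2 → ψ x = 0) →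
      HasCompactSupport ψ ∧ tsupport ψ ⊆ Ω := by
    intro ψ hψ
    have h1 : tsupport ψ ⊆ {x | 1 / 2 ≤ D x / ε} := by
      refine closure_minimal (fun x hx => ?_)
        (isClosed_le continuous_const (hD.continuous.div_const _))
      by_contra h
      exact hx (hψ x (not_le.1 h).le)
    have h2 : tsupport ψ ⊆ Ω := by
      intro x hx
      by_contra hxΩ
      have h3 : 1 / 2 ≤ D x / ε := h1 hx
      rw [le_div_iff₀ hεpos] at h3
      have h4 := (hDd' x).1
      rw [Metric.infDist_zero_of_mem (s := Ωᶜ) hxΩ] at h4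
      linarith
    exact ⟨Metric.isCompact_of_isClosed_isBounded (isClosed_tsupport _) (hb.subset h2), h2⟩
  have hfd : ∀ {Y : ℝ → ℝ}, ContDiff ℝ ∞ Y → ∀ x,
      fderiv ℝ (fun x => Y (D x / ε)) x = (deriv Y (D x / ε) / ε) • fderiv ℝ D x := by
    intro Y hY x
    have h1 : HasFDerivAt (fun x => D x / ε) (ε⁻¹ • fderiv ℝ D x) x := by
      simpa [div_eq_inv_mul] using
        ((hD.differentiable (by simp)) x).hasFDerivAt.const_mul ε⁻¹
    have h2 := ((hY.differentiable (by simp)) (D x / ε)).hasDerivAt.comp_hasFDerivAt x h1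
    rw [smul_smul, ← div_eq_mul_inv] at h2
    exact h2.fderiv
  have hbd : ∀ {Y : ℝ → ℝ}, ContDiff ℝ ∞ Y → (∀ t, |deriv Y t| ≤ M) → ∀ x,
      ‖fderiv ℝ (fun x => Y (D x / ε)) x‖ ≤ 4 * M / s := by
    intro Y hY hYM x
    have h1 : ‖fderiv ℝ D x‖ ≤ 1 := by
      simpa using norm_fderiv_le_of_lipschitz ℝ (x₀ := x) hDL
    have h2 : 0 ≤ M := (abs_nonneg _).trans (hYM 0)
    rw [hfd hY, norm_smul, norm_div, Real.norm_eq_abs, Real.norm_of_nonneg hεpos.le]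
    calc _ ≤ M / ε * 1 := by
          gcongr
          exact hYM _
      _ = 4 * M / s := by rw [hε]; field_simp
  have hη := hsup (ψ := fun x => X (D x / ε)) fun x hx => hX1 _ (by linarith)
  have hζ := hsup (ψ := fun x => Z (D x / ε)) fun x hx => hZ1 _ hx
  refine ⟨fun x => X (D x / ε), fun x => Z (D x / ε), hX.comp (hD.div_const _),
    hZ.comp (hD.div_const _), hη.1, hζ.1, hη.2, hζ.2, fun x => hX0 _, fun x hx => ?_,
    fun x => hZ0 _, fun x hx => ?_, fun x hx => ?_, hbd hX hXM, hbd hZ hZM⟩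
  · refine hX2 _ ?_
    rw [le_div_iff₀ hεpos]
    have := (hDd' x).2
    linarith
  · refine hXZ _ fun h => hx ?_
    rw [hfd hX, h]
    simp
  · have h1 : tsupport (fun x => Z (D x / ε)) ⊆ {x | D x / ε ≤ 3} := by
      refine closure_minimal (fun x hx => ?_)
        (isClosed_le (hD.continuous.div_const _) continuous_const)
      by_contra h
      exact hx (hZ2 _ (not_le.1 h).le)
    have h2 : D x / ε ≤ 3 := h1 hx
    rw [div_le_iff₀ hεpos] at h2
    have := (hDd' x).2
    linarith

end Cutoffs

/-! ### The weak formulation and its extension to `C¹` test functions -/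

section WeakFormulation

variable {N : ℕ} {Ω : Set (EuclideanSpace ℝ (Fin N))} {β : ℝ}
  {f u φ : EuclideanSpace ℝ (Fin N) → ℝ}

theorem bdryDist_eq_infDist_compl (hΩ : IsOpen Ω) (hne : Ω ≠ univ)
    {x : EuclideanSpace ℝ (Fin N)} (hx : x ∈ Ω) : bdryDist Ω x = Metric.infDist x Ωᶜ := by
  obtain ⟨y, hy, hxy⟩ := exists_mem_frontier_infDist_compl_eq_dist hx hne
  refine le_antisymm (hxy ▸ Metric.infDist_le_dist_of_mem hy) ?_
  refine Metric.infDist_le_infDist_of_subset (fun z hz hzΩ => ?_) ⟨y, hy⟩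
  have : z ∈ Ω ∩ frontier Ω := ⟨hzΩ, hz⟩
  simp [hΩ.inter_frontier_eq] at this

theorem bdryDist_pos (hΩ : IsOpen Ω) (hne : Ω ≠ univ) {x : EuclideanSpace ℝ (Fin N)}
    (hx : x ∈ Ω) : 0 < bdryDist Ω x := by
  rw [bdryDist_eq_infDist_compl hΩ hne hx]
  exact (hΩ.isClosed_compl.notMem_iff_infDist_pos (nonempty_compl.2 hne)).1 fun h => h hx

theorem continuousOn_bdryDist_rpow (hΩ : IsOpen Ω) (hne : Ω ≠ univ) (β : ℝ) :
    ContinuousOn (fun x => bdryDist Ω x ^ β) Ω :=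
  (Metric.continuous_infDist_pt _).continuousOn.rpow_const fun _ hx =>
    .inl (bdryDist_pos hΩ hne hx).ne'

theorem ContDiffOn.continuousOn_gradient {E : Type*} [NormedAddCommGroup E] [InnerProductSpace ℝ E]
    [CompleteSpace E] {Ω : Set E} {v : E → ℝ} (hv : ContDiffOn ℝ 1 v Ω) (hΩ : IsOpen Ω) :
    ContinuousOn (gradient v) Ω :=
  (InnerProductSpace.toDual ℝ E).symm.continuous.comp_continuousOn
    (hv.continuousOn_fderiv_of_isOpen hΩ le_rfl)

theorem norm_gradient {E : Type*} [NormedAddCommGroup E] [InnerProductSpace ℝ E]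
    [CompleteSpace E] (v : E → ℝ) (x : E) : ‖gradient v x‖ = ‖fderiv ℝ v x‖ :=
  LinearIsometryEquiv.norm_map _ _

theorem gradient_eq_zero_of_notMem_tsupport {E : Type*} [NormedAddCommGroup E]
    [InnerProductSpace ℝ E] [CompleteSpace E] {v : E → ℝ} {x : E} (hx : x ∉ tsupport v) :
    gradient v x = 0 := by
  rw [← norm_eq_zero, norm_gradient, norm_eq_zero]
  by_contra h
  exact hx (tsupport_fderiv_subset ℝ (f := v) (subset_closure h))

theorem ContinuousOn.integrableOn_of_eq_zero_off_compact {X : Type*} [TopologicalSpace X]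
    [T2Space X] [MeasurableSpace X] [BorelSpace X] {μ : Measure X} [IsFiniteMeasureOnCompacts μ]
    {Ω K : Set X} (hK : IsCompact K) (hKΩ : K ⊆ Ω) (hΩ : MeasurableSet Ω) {h : X → ℝ}
    (hh : ContinuousOn h Ω) (h0 : ∀ x ∈ Ω, x ∉ K → h x = 0) : IntegrableOn h Ω μ :=
  ((hh.mono hKΩ).integrableOn_compact hK).of_forall_sdiff_eq_zero hΩ fun x hx => h0 x hx.1 hx.2

theorem integrableOn_weak_left (hΩ : IsOpen Ω) (hne : Ω ≠ univ) (hu : ContDiffOn ℝ 1 u Ω)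
    (hφ : ContDiff ℝ 1 φ) (hc : HasCompactSupport φ) (hs : tsupport φ ⊆ Ω) :
    IntegrableOn (fun x => bdryDist Ω x ^ β * inner ℝ (gradient u x) (gradient φ x)) Ω := by
  refine ContinuousOn.integrableOn_of_eq_zero_off_compact hc hs hΩ.measurableSet
    ((continuousOn_bdryDist_rpow hΩ hne β).mul ((hu.continuousOn_gradient hΩ).inner
      (hφ.contDiffOn.continuousOn_gradient hΩ))) fun x _ hx => ?_
  rw [gradient_eq_zero_of_notMem_tsupport hx, inner_zero_right, mul_zero]

theorem integrableOn_weak_right (hΩ : IsOpen Ω) (hf : ContinuousOn f Ω) (hφ : Continuous φ)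
    (hc : HasCompactSupport φ) (hs : tsupport φ ⊆ Ω) :
    IntegrableOn (fun x => f x * φ x) Ω := by
  refine ContinuousOn.integrableOn_of_eq_zero_off_compact hc hs hΩ.measurableSet
    (hf.mul hφ.continuousOn) fun x _ hx => ?_
  rw [image_eq_zero_of_notMem_tsupport hx, mul_zero]

/-- The weak formulation extends to test functions of class `C¹`. -/
theorem DegeneratePoisson.SolvesEquation.of_contDiff_one (h : SolvesEquation Ω β f u)
    (hΩ : IsOpen Ω) (hne : Ω ≠ univ) (hf : ContinuousOn f Ω) (hu : ContDiffOn ℝ 1 u Ω)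
    (hφ : ContDiff ℝ 1 φ) (hc : HasCompactSupport φ) (hs : tsupport φ ⊆ Ω) :
    ∫ x in Ω, bdryDist Ω x ^ β * inner ℝ (gradient u x) (gradient φ x) =
      ∫ x in Ω, f x * φ x := by
  obtain ⟨δ, hδ, hδΩ⟩ := hc.exists_cthickening_subset_open hΩ hs
  set K := Metric.cthickening δ (tsupport φ)
  have hK : IsCompact K := hc.cthickening
  have hφK : tsupport φ ⊆ K := Metric.self_subset_cthickening _
  have hA : ContinuousOn (fun x => bdryDist Ω x ^ β * ‖gradient u x‖ + |f x|) K :=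
    (((continuousOn_bdryDist_rpow hΩ hne β).mul (hu.continuousOn_gradient hΩ).norm).add
      hf.abs).mono hδΩ
  set M := ∫ x in K, (bdryDist Ω x ^ β * ‖gradient u x‖ + |f x|)
  -- The equation holds for a mollified `ψ`, and replacing `φ` by `ψ` costs at most `M ε`, all
  -- supports lying in the fixed compact set `K`.
  have hM : ∀ ε > 0, |(∫ x in Ω, bdryDist Ω x ^ β * inner ℝ (gradient u x) (gradient φ x)) -
      ∫ x in Ω, f x * φ x| ≤ M * ε := by
    intro ε hε
    obtain ⟨ψ, hψ, hψs, h0, h1⟩ := exists_contDiff_approx hφ hc hδ hε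
    have hψ1 : ContDiff ℝ 1 ψ := hψ.of_le (by simp)
    have hψc : HasCompactSupport ψ := hK.of_isClosed_subset (isClosed_tsupport _) hψs
    have hψΩ := hψs.trans hδΩ
    have i1 := integrableOn_weak_left (β := β) hΩ hne hu hφ hc hs
    have i2 := integrableOn_weak_left (β := β) hΩ hne hu hψ1 hψc hψΩ
    have i3 := integrableOn_weak_right hΩ hf hφ.continuous hc hs
    have i4 := integrableOn_weak_right hΩ hf hψ.continuous hψc hψΩ
    have i13 : IntegrableOn (fun x => bdryDist Ω x ^ β * inner ℝ (gradient u x) (gradient φ x) -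
      f x * φ x) Ω := i1.sub i3
    have i24 : IntegrableOn (fun x => bdryDist Ω x ^ β * inner ℝ (gradient u x) (gradient ψ x) -
      f x * ψ x) Ω := i2.sub i4
    have e := h ψ hψ hψc hψΩ
    have e2 : (∫ x in Ω, bdryDist Ω x ^ β * inner ℝ (gradient u x) (gradient φ x)) -
        ∫ x in Ω, f x * φ x = ∫ x in Ω,
          ((bdryDist Ω x ^ β * inner ℝ (gradient u x) (gradient φ x) - f x * φ x) -
          (bdryDist Ω x ^ β * inner ℝ (gradient u x) (gradient ψ x) - f x * ψ x)) := by
      rw [integral_sub i13 i24, integral_sub i1 i3, integral_sub i2 i4, e, sub_self,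
        sub_zero]
    rw [e2, setIntegral_eq_of_subset_of_forall_sdiff_eq_zero hΩ.measurableSet hδΩ ?_,
      ← integral_mul_const, ← Real.norm_eq_abs]
    · refine norm_integral_le_of_norm_le ((hA.integrableOn_compact hK).mul_const ε)
        ((ae_restrict_iff' hK.measurableSet).2 (Eventually.of_forall fun x _ => ?_))
      have e3 : (bdryDist Ω x ^ β * inner ℝ (gradient u x) (gradient φ x) - f x * φ x) -
          (bdryDist Ω x ^ β * inner ℝ (gradient u x) (gradient ψ x) - f x * ψ x) =
          f x * (ψ x - φ x) -
            bdryDist Ω x ^ β * inner ℝ (gradient u x) (gradient ψ x - gradient φ x) := by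
        rw [inner_sub_right]; ring
      have hd : 0 ≤ bdryDist Ω x ^ β := Real.rpow_nonneg Metric.infDist_nonneg β
      have hg : ‖gradient ψ x - gradient φ x‖ ≤ ε := by
        have : gradient ψ x - gradient φ x = (InnerProductSpace.toDual ℝ _).symm
            (fderiv ℝ ψ x - fderiv ℝ φ x) := by rw [map_sub]; rfl
        rw [this, LinearIsometryEquiv.norm_map]
        exact h1 x
      rw [e3]
      refine (norm_sub_le _ _).trans ?_
      rw [norm_mul, norm_mul, Real.norm_of_nonneg hd, add_mul, Real.norm_eq_abs, Real.norm_eq_abs,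
        add_comm]
      have h3 := norm_inner_le_norm (𝕜 := ℝ) (gradient u x) (gradient ψ x - gradient φ x)
      have h4 : ‖inner ℝ (gradient u x) (gradient ψ x - gradient φ x)‖ ≤ ‖gradient u x‖ * ε :=
        h3.trans (by gcongr)
      rw [mul_assoc]
      gcongr
      exact h0 x
    · rintro x ⟨_, hx⟩
      have hx1 : x ∉ tsupport φ := fun h => hx (hφK h)
      have hx2 : x ∉ tsupport ψ := fun h => hx (hψs h)
      simp [gradient_eq_zero_of_notMem_tsupport hx1, gradient_eq_zero_of_notMem_tsupport hx2,
        image_eq_zero_of_notMem_tsupport hx1, image_eq_zero_of_notMem_tsupport hx2]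
  have hlim : Tendsto (fun ε => M * ε) (𝓝[>] 0) (𝓝 0) := by
    have : Tendsto (fun ε => M * ε) (𝓝 0) (𝓝 (M * 0)) := tendsto_const_nhds.mul tendsto_id
    rw [mul_zero] at this
    exact this.mono_left nhdsWithin_le_nhds
  have h0 := ge_of_tendsto hlim (eventually_mem_nhdsWithin.mono fun ε hε => hM ε hε)
  exact sub_eq_zero.1 (abs_nonpos_iff.1 h0)

end WeakFormulation

/-! ### The exponent is at most `1` -/

section UpperBound

variable {N : ℕ} {Ω : Set (EuclideanSpace ℝ (Fin N))} {β : ℝ}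
  {f u : EuclideanSpace ℝ (Fin N) → ℝ}

theorem DegeneratePoisson.IsBoundedC2Domain.ne_univ (hN : 2 ≤ N) (hΩ : IsBoundedC2Domain Ω) :
    Ω ≠ univ := by
  have := nontrivial_euclideanSpace hN
  rintro rfl
  exact NormedSpace.unbounded_univ ℝ (EuclideanSpace ℝ (Fin N)) hΩ.isBounded

/-- On a ball of radius `r` in `Ω` the source exceeds half its value at the centre, and the
concentric ball of radius `r / 2` keeps distance `r / 2` from the complement, so `η = 1` there. The
bound `m` does not depend on `η`, which allows the layer to shrink. -/
theorem DegeneratePoisson.IsSource.exists_integral_lower_bound (hf : IsSource Ω f)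
    (hΩ : IsOpen Ω) (hne : Ω ≠ univ) :
    ∃ m > 0, ∃ s₀ > 0, ∀ η : EuclideanSpace ℝ (Fin N) → ℝ, Continuous η → HasCompactSupport η →
      tsupport η ⊆ Ω → (∀ x, 0 ≤ η x) → (∀ x, s₀ ≤ Metric.infDist x Ωᶜ → η x = 1) →
      m ≤ ∫ x in Ω, f x * η x := by
  obtain ⟨x₁, hx₁, hfx⟩ := hf.ne_zero
  have hpos : 0 < f x₁ := lt_of_le_of_ne (hf.nonneg x₁ hx₁) hfx.symm
  have hfc : ContinuousOn f Ω := hf.continuousOn.mono subset_closure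
  obtain ⟨r, hr, hrΩ⟩ := Metric.mem_nhds_iff.1 (Filter.inter_mem (hΩ.mem_nhds hx₁)
    ((hfc.continuousAt (hΩ.mem_nhds hx₁)).eventually_const_lt (half_lt_self hpos)))
  have hr2 : 0 < r / 2 := by positivity
  refine ⟨f x₁ / 2 * volume.real (Metric.ball x₁ (r / 2)),
    mul_pos (half_pos hpos) (ENNReal.toReal_pos (Metric.measure_ball_pos _ _ hr2).ne'
      measure_ball_lt_top.ne), r / 2, hr2, fun η hη hc hs hη0 hη1 => ?_⟩
  have hsub : Metric.ball x₁ (r / 2) ⊆ Ω := fun x hx =>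
    (hrΩ (Metric.ball_subset_ball (by linarith) hx)).1
  have hint := integrableOn_weak_right hΩ hfc hη hc hs
  calc _ = ∫ x in Metric.ball x₁ (r / 2), f x₁ / 2 := by
        rw [setIntegral_const, smul_eq_mul, mul_comm]
    _ ≤ ∫ x in Metric.ball x₁ (r / 2), f x * η x := by
        refine setIntegral_mono_on (integrableOn_const measure_ball_lt_top.ne)
          (hint.mono_set hsub) measurableSet_ball fun x hx => ?_
        have h1 : η x = 1 := by
          refine hη1 x ((Metric.le_infDist (nonempty_compl.2 hne)).2 fun y hy => ?_)
          have h2 : r ≤ dist y x₁ := not_lt.1 fun h => hy (hrΩ h).1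
          have h3 := dist_triangle y x x₁
          rw [Metric.mem_ball] at hx
          rw [dist_comm x y]
          linarith
        rw [h1, mul_one]
        exact (hrΩ (Metric.ball_subset_ball (by linarith) hx)).2.le
    _ ≤ _ := setIntegral_mono_set hint ((ae_restrict_iff' hΩ.measurableSet).2
        (Eventually.of_forall fun x hx => mul_nonneg (hf.nonneg x hx) (hη0 x)))
        hsub.eventuallyLE

theorem hasFDerivAt_zero_of_holderOnWith {E : Type*} [NormedAddCommGroup E] [NormedSpace ℝ E]
    {Ω : Set E} {u : E → ℝ} {C α : ℝ≥0} (h : HolderOnWith C α u Ω) (hα : 1 < α) {x : E}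
    (hx : Ω ∈ 𝓝 x) : HasFDerivAt u (0 : E →L[ℝ] ℝ) x := by
  rw [hasFDerivAt_iff_isLittleO]
  have hα' : (0 : ℝ) < α - 1 := sub_pos.2 (by exact_mod_cast hα)
  refine Asymptotics.isLittleO_iff.2 fun c hc => ?_
  have hlim : Tendsto (fun y => C * ‖y - x‖ ^ ((α : ℝ) - 1)) (𝓝 x) (𝓝 0) := by
    have h1 : Continuous fun y => C * ‖y - x‖ ^ ((α : ℝ) - 1) :=
      continuous_const.mul ((by fun_prop : Continuous fun y => ‖y - x‖).rpow_const
        fun _ => .inr hα'.le)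
    have := h1.tendsto x
    simpa [Real.zero_rpow hα'.ne'] using this
  filter_upwards [hx, hlim.eventually_lt_const hc] with y hy hyc
  have h1 := h.dist_le hy (mem_of_mem_nhds hx)
  rw [Real.dist_eq, dist_eq_norm] at h1
  rw [zero_apply, sub_zero, Real.norm_eq_abs]
  refine h1.trans ?_
  have h2 : ‖y - x‖ ^ (α : ℝ) = ‖y - x‖ ^ ((α : ℝ) - 1) * ‖y - x‖ := by
    rw [← Real.rpow_add_one' (norm_nonneg _) (by linarith)]
    simp
  rw [h2, ← mul_assoc]
  exact mul_le_mul_of_nonneg_right hyc.le (norm_nonneg _)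

/-- A Hölder exponent above `1` forces `∇u = 0`, so testing with a single cutoff contradicts the
positivity of `∫ f η`. -/
theorem holder_exponent_le_one (hN : 2 ≤ N) (hΩ : IsBoundedC2Domain Ω) (hf : IsSource Ω f)
    (hu : IsSolution Ω β f u) {α : ℝ≥0} (hα : IsHolderUpToBoundary Ω α u) : α ≤ 1 := by
  by_contra! h
  obtain ⟨C, hC⟩ := hα
  have hne := hΩ.ne_univ hN
  obtain ⟨m, hm, s₀, hs₀, hlow⟩ := hf.exists_integral_lower_bound hΩ.isOpen hne
  obtain ⟨M, hM⟩ := exists_cutoffs hΩ.isBounded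
  obtain ⟨η, ζ, hη, -, hηc, -, hηs, -, hη0, hη1, -⟩ := hM s₀ hs₀
  have h1 := hlow η hη.continuous hηc hηs hη0 hη1
  have h2 : ∫ x in Ω, bdryDist Ω x ^ β * inner ℝ (gradient u x) (gradient η x) = 0 := by
    refine setIntegral_eq_zero_of_forall_eq_zero fun x hx => ?_
    have h3 : gradient u x = 0 := by
      rw [← norm_eq_zero, norm_gradient, norm_eq_zero]
      exact (hasFDerivAt_zero_of_holderOnWith (hC.mono subset_closure) h
        (hΩ.isOpen.mem_nhds hx)).fderiv
    rw [h3, inner_zero_left, mul_zero]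
  rw [hu.equation η hη hηc hηs] at h2
  linarith

end UpperBound

/-! ### The exponent is at most `1 - β` -/

section UpperBoundWeighted

variable {N : ℕ} {Ω : Set (EuclideanSpace ℝ (Fin N))} {β : ℝ}
  {f u ζ : EuclideanSpace ℝ (Fin N) → ℝ}

/-- The pointwise inequality behind the Caccioppoli estimate. -/
theorem inner_sub_le_of_caccioppoli {E : Type*} [NormedAddCommGroup E] [InnerProductSpace ℝ E]
    {a b c : E} {y v z : ℝ} (hy : 0 < y) (hb : b ≠ 0 → z = 1) :
    inner ℝ a b - 2 / y * (2 * z * v * inner ℝ a c + z ^ 2 * ‖a‖ ^ 2) ≤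
      4 / y * v ^ 2 * ‖c‖ ^ 2 + y / 4 * ‖b‖ ^ 2 := by
  -- Two applications of Young's inequality, here and in `h2`, each cost one `z² |a|²`; the factor
  -- `2 / y` in the statement pays for both.
  have h1 : y * inner ℝ a b ≤ z ^ 2 * ‖a‖ ^ 2 + y ^ 2 / 4 * ‖b‖ ^ 2 := by
    rcases eq_or_ne b 0 with rfl | h
    · simp only [inner_zero_right, mul_zero, norm_zero]
      positivity
    · rw [hb h]
      nlinarith [real_inner_le_norm a b, sq_nonneg (‖a‖ - y / 2 * ‖b‖)]
  have h2 : -(4 * (z * v) * inner ℝ a c) ≤ z ^ 2 * ‖a‖ ^ 2 + 4 * v ^ 2 * ‖c‖ ^ 2 := by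
    have h3 : -((z * v) * inner ℝ a c) ≤ |z * v| * (‖a‖ * ‖c‖) := by
      refine (neg_le_abs _).trans ?_
      rw [abs_mul]
      exact mul_le_mul_of_nonneg_left (abs_real_inner_le_norm a c) (abs_nonneg _)
    rw [abs_mul] at h3
    nlinarith [sq_nonneg (|z| * ‖a‖ - 2 * (|v| * ‖c‖)), sq_abs z, sq_abs v]
  have h4 : y * (inner ℝ a b - 2 / y * (2 * z * v * inner ℝ a c + z ^ 2 * ‖a‖ ^ 2)) ≤
      y * (4 / y * v ^ 2 * ‖c‖ ^ 2 + y / 4 * ‖b‖ ^ 2) := by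
    field_simp
    nlinarith
  exact le_of_mul_le_mul_left h4 hy

theorem contDiff_sq_mul_of_tsupport_subset (hΩ : IsOpen Ω) (hu : ContDiffOn ℝ 1 u Ω)
    (hζ : ContDiff ℝ 1 ζ) (hs : tsupport ζ ⊆ Ω) : ContDiff ℝ 1 fun x => ζ x ^ 2 * u x := by
  rw [contDiff_iff_contDiffAt]
  intro x
  by_cases hx : x ∈ tsupport ζ
  · exact (hζ.contDiffAt.pow 2).mul (hu.contDiffAt (hΩ.mem_nhds (hs hx)))
  · have : (fun x => ζ x ^ 2 * u x) =ᶠ[𝓝 x] fun _ => 0 := by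
      filter_upwards [notMem_tsupport_iff_eventuallyEq.1 hx] with y hy
      simp [hy]
    exact contDiffAt_const.congr_of_eventuallyEq this

theorem tsupport_sq_mul_subset {X : Type*} [TopologicalSpace X] (ζ u : X → ℝ) :
    tsupport (fun x => ζ x ^ 2 * u x) ⊆ tsupport ζ :=
  closure_mono fun x hx h => hx (by simp [h])

theorem inner_gradient_sq_mul (hΩ : IsOpen Ω) (hu : ContDiffOn ℝ 1 u Ω)
    (hζ : ContDiff ℝ 1 ζ) {x : EuclideanSpace ℝ (Fin N)} (hx : x ∈ Ω) :
    inner ℝ (gradient u x) (gradient (fun x => ζ x ^ 2 * u x) x) =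
      2 * ζ x * u x * inner ℝ (gradient u x) (gradient ζ x) + ζ x ^ 2 * ‖gradient u x‖ ^ 2 := by
  have h1 := ((hu.differentiableOn one_ne_zero).differentiableAt (hΩ.mem_nhds hx)).hasFDerivAt
  have h2 := ((hζ.differentiable one_ne_zero) x).hasFDerivAt
  have h3 : fderiv ℝ (ζ ^ 2 * u) x = _ := ((h2.pow 2).mul h1).fderiv
  rw [real_inner_comm, inner_gradient_left,
    show (fun x => ζ x ^ 2 * u x) = ζ ^ 2 * u from rfl, h3]
  rw [real_inner_comm (gradient ζ x), inner_gradient_left, ← real_inner_self_eq_norm_sq,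
    inner_gradient_left]
  simp
  ring

/-- Near the boundary, a Hölder continuous solution is bounded by a power of the distance. -/
theorem abs_le_bdryDist_rpow (hne : (frontier Ω).Nonempty) {C α : ℝ≥0}
    (hC : HolderOnWith C α u (closure Ω)) (h0 : ∀ x ∈ frontier Ω, u x = 0)
    {x : EuclideanSpace ℝ (Fin N)} (hx : x ∈ Ω) : |u x| ≤ C * bdryDist Ω x ^ (α : ℝ) := by
  obtain ⟨z, hz, hxz⟩ := isClosed_frontier.exists_infDist_eq_dist hne x
  have := hC.dist_le (subset_closure hx) (frontier_subset_closure hz)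
  rwa [h0 z hz, Real.dist_eq, sub_zero, ← hxz] at this

/-- Caccioppoli's argument in the layer of width `s`. Positivity of `β` enters through `d^β ≤ s^β`.
-/
theorem holder_exponent_add_le_one (hN : 2 ≤ N) (hβ : 0 < β) (hΩ : IsBoundedC2Domain Ω)
    (hf : IsSource Ω f) (hu : IsSolution Ω β f u) {α : ℝ≥0} (hα : IsHolderUpToBoundary Ω α u) :
    (α : ℝ) + β ≤ 1 := by
  by_contra! hαβ
  obtain ⟨H, hH⟩ := hα
  have hne := hΩ.ne_univ hN
  have hopen := hΩ.isOpen
  have hfr : (frontier Ω).Nonempty := by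
    obtain ⟨x, hx⟩ := hΩ.isConnected.nonempty
    obtain ⟨y, hy, -⟩ := exists_mem_frontier_infDist_compl_eq_dist hx hne
    exact ⟨y, hy⟩
  have hu1 : ContDiffOn ℝ 1 u Ω := hu.contDiffOn.of_le one_le_two
  have hfc : ContinuousOn f Ω := hf.continuousOn.mono subset_closure
  obtain ⟨F, hF⟩ := hΩ.isBounded.isCompact_closure.exists_bound_of_continuousOn hf.continuousOn
  have hF0 : 0 ≤ F := by
    obtain ⟨x, hx⟩ := hΩ.isConnected.nonempty
    exact (norm_nonneg _).trans (hF x (subset_closure hx))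
  obtain ⟨m, hm, s₀, hs₀, hlow⟩ := hf.exists_integral_lower_bound hopen hne
  obtain ⟨ε₀, hε₀, C, hC0, hC⟩ := hΩ.exists_measureReal_thickening_le
  obtain ⟨M, hM⟩ := exists_cutoffs hΩ.isBounded
  have key : ∀ s ∈ Ioo 0 (min s₀ ε₀),
      m ≤ C * (M ^ 2 * (4 * H ^ 2 + 1 / 4) * s ^ ((α : ℝ) + β - 1) + 2 * F * H * s) := by
    rintro s ⟨hs, hsm⟩
    obtain ⟨η, ζ, hη, hζ, hηc, hζc, hηs, hζs, hη0, hη1, hζ01, hηζ, hζd, hηM, hζM⟩ := hM s hs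
    have hη' : ContDiff ℝ 1 η := hη.of_le (by simp)
    have hζ' : ContDiff ℝ 1 ζ := hζ.of_le (by simp)
    set φ := fun x => ζ x ^ 2 * u x with hφdef
    have hφ := contDiff_sq_mul_of_tsupport_subset hopen hu1 hζ' hζs
    have hφt : tsupport φ ⊆ tsupport ζ := tsupport_sq_mul_subset ζ u
    have hφc : HasCompactSupport φ := hζc.of_isClosed_subset (isClosed_tsupport _) hφt
    have hφs := hφt.trans hζs
    have eη := hu.equation η hη hηc hηs
    have eφ := hu.equation.of_contDiff_one hopen hne hfc hu1 hφ hφc hφs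
    have i1 := integrableOn_weak_left (β := β) hopen hne hu1 hη' hηc hηs
    have i2 := integrableOn_weak_left (β := β) hopen hne hu1 hφ hφc hφs
    have i3 := integrableOn_weak_right hopen hfc hφ.continuous hφc hφs
    -- The Young parameter is the size of `u` in the layer; it makes both gradient terms of order
    -- `s^{α-2}`.
    set y := s ^ (α : ℝ) with hy
    have hypos : 0 < y := Real.rpow_pos_of_pos hs _
    have i23 : IntegrableOn (fun x => 2 / y * (bdryDist Ω x ^ β *
      inner ℝ (gradient u x) (gradient φ x) - f x * φ x)) Ω := (i2.sub i3).const_mul _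
    -- The subtracted multiple has integral zero by the equation tested with `φ = ζ² u`. Inserting
    -- it under the integral reduces the whole estimate to a pointwise one.
    have eG : ∫ x in Ω, f x * η x = ∫ x in Ω, (bdryDist Ω x ^ β *
        inner ℝ (gradient u x) (gradient η x) - 2 / y * (bdryDist Ω x ^ β *
          inner ℝ (gradient u x) (gradient φ x) - f x * φ x)) := by
      rw [integral_sub i1 i23, integral_const_mul, integral_sub i2 i3, eη, eφ]
      ring
    set T := Metric.thickening s (frontier Ω) with hT
    have hTm : MeasurableSet T := Metric.isOpen_thickening.measurableSet
    have hTfin : volume T ≠ ⊤ :=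
      ((hΩ.isBounded.closure.subset frontier_subset_closure).thickening).measure_lt_top.ne
    set B := s ^ β * (4 * H ^ 2 * y * M ^ 2 / s ^ 2 + M ^ 2 * y / (4 * s ^ 2)) + 2 * F * H with hB
    have hB0 : 0 ≤ B := by positivity
    have hpt : ∀ x ∈ Ω, bdryDist Ω x ^ β * inner ℝ (gradient u x) (gradient η x) -
        2 / y * (bdryDist Ω x ^ β * inner ℝ (gradient u x) (gradient φ x) - f x * φ x) ≤
        T.indicator (fun _ => B) x := by
      intro x hx
      have hηg : gradient η x ≠ 0 → ζ x = 1 := fun h => hηζ x fun h' => h (by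
        rw [← norm_eq_zero, norm_gradient, h', norm_zero])
      by_cases hxζ : x ∈ tsupport ζ
      · have hds : bdryDist Ω x < s := by
          rw [bdryDist_eq_infDist_compl hopen hne hx]; exact hζd x hxζ
        have hxT : x ∈ T := Metric.mem_thickening_iff.2 ((Metric.infDist_lt_iff hfr).1 hds)
        have hd0 : 0 ≤ bdryDist Ω x := Metric.infDist_nonneg
        rw [indicator_of_mem hxT, inner_gradient_sq_mul hopen hu1 hζ' hx]
        have h1 := inner_sub_le_of_caccioppoli (a := gradient u x) (c := gradient ζ x)
          (v := u x) hypos hηg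
        have hux : |u x| ≤ H * y := (abs_le_bdryDist_rpow hfr hH hu.boundary hx).trans
          (mul_le_mul_of_nonneg_left (Real.rpow_le_rpow hd0 hds.le α.coe_nonneg) H.coe_nonneg)
        have hu2 : u x ^ 2 ≤ (H * y) ^ 2 := by
          rw [← sq_abs]; gcongr
        have hg1 : ‖gradient ζ x‖ ≤ M / s := norm_gradient ζ x ▸ hζM x
        have hg2 : ‖gradient η x‖ ≤ M / s := norm_gradient η x ▸ hηM x
        have h2 : 4 / y * u x ^ 2 * ‖gradient ζ x‖ ^ 2 + y / 4 * ‖gradient η x‖ ^ 2 ≤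
            4 * H ^ 2 * y * M ^ 2 / s ^ 2 + M ^ 2 * y / (4 * s ^ 2) := by
          calc _ ≤ 4 / y * (H * y) ^ 2 * (M / s) ^ 2 + y / 4 * (M / s) ^ 2 := by gcongr
            _ = _ := by field_simp
        have h3 : bdryDist Ω x ^ β ≤ s ^ β := by gcongr
        have h4 : bdryDist Ω x ^ β * (inner ℝ (gradient u x) (gradient η x) -
            2 / y * (2 * ζ x * u x * inner ℝ (gradient u x) (gradient ζ x) +
              ζ x ^ 2 * ‖gradient u x‖ ^ 2)) ≤
            s ^ β * (4 * H ^ 2 * y * M ^ 2 / s ^ 2 + M ^ 2 * y / (4 * s ^ 2)) :=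
          (mul_le_mul_of_nonneg_left (h1.trans h2) (Real.rpow_nonneg hd0 β)).trans
            (mul_le_mul_of_nonneg_right h3 (by positivity))
        have h5 : f x * φ x ≤ F * (H * y) := by
          refine (le_abs_self _).trans ?_
          rw [hφdef, abs_mul, abs_mul]
          have h6 : |ζ x ^ 2| ≤ 1 := by
            rw [abs_of_nonneg (sq_nonneg _)]
            exact pow_le_one₀ (hζ01 x).1 (hζ01 x).2
          have h7 : |f x| ≤ F := hF x (subset_closure hx)
          calc _ ≤ F * (1 * (H * y)) := by gcongr
            _ = _ := by ring
        have h8 : 2 / y * (f x * φ x) ≤ 2 * F * H := by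
          calc _ ≤ 2 / y * (F * (H * y)) := by gcongr
            _ = _ := by field_simp
        rw [hB]
        linarith
      -- Off the support of `ζ` the integrand vanishes: `∇η ≠ 0` would force `ζ = 1`.
      · have hz : ζ x = 0 := image_eq_zero_of_notMem_tsupport hxζ
        have hg : gradient η x = 0 := by
          by_contra h
          simp [hηg h] at hz
        have hg2 : gradient φ x = 0 := gradient_eq_zero_of_notMem_tsupport fun h => hxζ (hφt h)
        have hφ0 : φ x = 0 := by simp [hφdef, hz]
        rw [hg, hg2, hφ0]
        simpa using indicator_nonneg (fun _ _ => hB0) x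
    have hvol := hC s hs (hsm.le.trans (min_le_right _ _))
    have hup : ∫ x in Ω, f x * η x ≤ B * (C * s) := by
      rw [eG]
      calc _ ≤ ∫ x in Ω, T.indicator (fun _ => B) x :=
            setIntegral_mono_on (i1.sub i23)
              (((integrable_indicator_iff hTm).2 (integrableOn_const hTfin)).integrableOn)
              hopen.measurableSet hpt
        _ = B * volume.real (Ω ∩ T) := by
            rw [setIntegral_indicator hTm, setIntegral_const, smul_eq_mul, mul_comm]
        _ ≤ B * (C * s) := by
            refine mul_le_mul_of_nonneg_left ?_ hB0
            exact (measureReal_mono inter_subset_right hTfin).trans hvol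
    have hmle := (hlow η hη.continuous hηc hηs hη0 fun x hx =>
      hη1 x ((hsm.le.trans (min_le_left _ _)).trans hx)).trans hup
    refine hmle.trans (le_of_eq ?_)
    have hpow : s ^ ((α : ℝ) + β - 1) = y * s ^ β / s := by
      rw [Real.rpow_sub_one hs.ne', Real.rpow_add hs]
    rw [hpow, hB]
    field_simp
  have hlim : Tendsto (fun s : ℝ => C * (M ^ 2 * (4 * H ^ 2 + 1 / 4) * s ^ ((α : ℝ) + β - 1) +
      2 * F * H * s)) (𝓝[>] 0) (𝓝 0) := by
    have hp : 0 < (α : ℝ) + β - 1 := by linarith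
    have h1 : Continuous fun s : ℝ => C * (M ^ 2 * (4 * H ^ 2 + 1 / 4) * s ^ ((α : ℝ) + β - 1) +
        2 * F * H * s) :=
      continuous_const.mul ((continuous_const.mul (continuous_id.rpow_const fun _ =>
        .inr hp.le)).add (continuous_const.mul continuous_id))
    have h2 := h1.tendsto 0
    simp only [Real.zero_rpow hp.ne', mul_zero, add_zero] at h2
    exact h2.mono_left nhdsWithin_le_nhds
  -- Letting `s → 0` gives `m ≤ 0`.
  have := ge_of_tendsto hlim (by
    filter_upwards [Ioo_mem_nhdsGT (lt_min hs₀ hε₀)] with s hs using key s hs)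
  linarith

theorem holder_exponent_le (hN : 2 ≤ N) (hΩ : IsBoundedC2Domain Ω)
    (hf : IsSource Ω f) (hu : IsSolution Ω β f u) {α : ℝ≥0} (hα : IsHolderUpToBoundary Ω α u) :
    (α : ℝ) ≤ min 1 (1 - β) := by
  have h1 : (α : ℝ) ≤ 1 := by exact_mod_cast holder_exponent_le_one hN hΩ hf hu hα
  refine le_min h1 ?_
  rcases le_or_gt β 0 with hβ | hβ
  · linarith
  · have := holder_exponent_add_le_one hN hβ hΩ hf hu hα
    linarith

end UpperBoundWeighted

theorem theorem1p3 (N : ℕ) (hN : 2 ≤ N) (β : ℝ) (hβ : β < 1) :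
    -- the upper bound on the Hölder exponent
    (∀ Ω : Set (EuclideanSpace ℝ (Fin N)), IsBoundedC2Domain Ω →
      ∀ f u : EuclideanSpace ℝ (Fin N) → ℝ, IsSource Ω f → IsSolution Ω β f u →
      ∀ α : ℝ≥0, 0 < α → IsHolderUpToBoundary Ω α u → (α : ℝ) ≤ min 1 (1 - β)) ∧
    -- sharpness, on the unit ball
    IsBoundedC2Domain (unitBall N) ∧
    (0 ≤ β →
      IsSource (unitBall N) (fun x => bdryDist (unitBall N) x ^ β) ∧
      IsSolution (unitBall N) β (fun x => bdryDist (unitBall N) x ^ β) (radialSolution₁ N β) ∧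
      (∀ x ∈ unitBall N, 0 < radialSolution₁ N β x) ∧
      (∃ c : ℝ, 0 < c ∧ Tendsto (fun x => radialSolution₁ N β x / (1 - ‖x‖) ^ (1 - β))
        (comap norm (𝓝[<] 1)) (𝓝 c)) ∧
      ∀ α : ℝ≥0, 0 < α →
        (IsHolderUpToBoundary (unitBall N) α (radialSolution₁ N β) ↔ (α : ℝ) ≤ 1 - β)) ∧
    (IsSource (unitBall N) (fun _ => 1) ∧
      IsSolution (unitBall N) β (fun _ => 1) (radialSolution₂ N β) ∧
      (∀ x ∈ unitBall N, 0 < radialSolution₂ N β x) ∧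
      ∀ α : ℝ≥0, 0 < α →
        (IsHolderUpToBoundary (unitBall N) α (radialSolution₂ N β) ↔
          (α : ℝ) ≤ min 1 (1 - β))) := by
  refine ⟨fun Ω hΩ f u hf hu α _ hα => holder_exponent_le hN hΩ hf hu hα,
    isBoundedC2Domain_unitBall, fun hβ0 => ?_, ?_⟩
  · have hprof := isRadialProfile_radialSolution₁ hN hβ0 hβ
    have heq : ∀ x : EuclideanSpace ℝ (Fin N), ‖x‖ ≤ 1 → radialSolution₁ N β x =
        ∫ s in ‖x‖..1, s * ((1 - s) ^ (-β) * normalizedFlux N β s) :=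
      fun x hx => radialSolution₁_eq hx
    have hsrc := isSource_rpow_bdryDist_unitBall hN hβ0
    have hsol := hprof.isSolution hN (F := fun x => bdryDist (unitBall N) x ^ β)
      (fun x hx => by simp only [bdryDist_unitBall hN hx.le]) heq
    refine ⟨hsrc, hsol, fun x hx => ?_,
      ⟨normalizedFlux N β 1 / (1 - β), div_pos (normalizedFlux_pos hN hβ0 le_rfl)
        (sub_pos.2 hβ), ?_⟩, fun α _ => ⟨fun h => ?_, fun h => ?_⟩⟩
    · rw [heq x (mem_unitBall.1 hx).le]
      exact hprof.pos ⟨norm_nonneg x, mem_unitBall.1 hx⟩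
    · have hlim := hprof.tendsto_div_rpow hβ
        (((continuous_normalizedFlux hN hβ0).tendsto 1).mono_left nhdsWithin_le_nhds)
      refine (hlim.comp tendsto_comap).congr' ?_
      filter_upwards [preimage_mem_comap self_mem_nhdsWithin] with x hx
      rw [Function.comp_apply, heq x (le_of_lt hx)]
    · exact (holder_exponent_le hN isBoundedC2Domain_unitBall hsrc hsol h).trans (min_le_right _ _)
    · exact hprof.isHolderUpToBoundary hβ heq (le_min (by linarith) h)
  · have hprof := isRadialProfile_radialSolution₂ hN hβ
    have hsol := hprof.isSolution hN (F := fun _ => 1) (u := radialSolution₂ N β)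
      (fun _ _ => rfl) fun _ _ => rfl
    exact ⟨isSource_one, hsol, fun x hx => hprof.pos ⟨norm_nonneg x, mem_unitBall.1 hx⟩,
      fun α _ => ⟨holder_exponent_le hN isBoundedC2Domain_unitBall isSource_one hsol,
        hprof.isHolderUpToBoundary hβ fun _ _ => rfl⟩⟩
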